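/- Let $E$ be a finite or countable set, let $\ell^2(E)$ be the real or complex Hilbert space with standard orthonormal basis $(\mathbf 1_e)_{e\in E}$, and equip $2^E$ (the set of subsets of $E$) with the product $\sigma$-algebra. For a closed subspace $K\subseteq\ell^2(E)$ with orthogonal projection $P_K$, let $\mathbf P^K$ denote the determinantal probability measure of $K$, i.e. the unique probability measure on $2^E$ such that $$\mathbf P^K\{B : A\subseteq B\}=\det\big[\langle P_K\mathbf 1_f,\mathbf 1_e\rangle\big]_{e,f\in A}\qquad\text{for every finite }A\subseteq E .$$ A monotone coupling of two probability measures $\mathbf P^1,\mathbf P^2$ on $2^E$ is a probability measure $\mu$ on $2^E\times 2^E$ with coordinate projections $\mathbf P^1$ and $\mathbf P^2$ such that $\mu\{(B_1,B_2): B_1\subseteq B_2\}=1$. (a) If $H\subseteq H'$ are closed subspaces of $\ell^2(E)$, then $\mathbf P^H$ and $\mathbf P^{H'}$ exist and there is a monotone coupling $\mu$ of $\mathbf P^H$ and $\mathbf P^{H'}$ with $$\mu\{(B_1,B_2): |B_2\setminus B_1|=k\}=1,$$ where $k\in\{0,1,2,\dots\}\cup\{\infty\}$ is the codimension of $H$ in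 $H'$. (b) Let $H$ be a finite-dimensional subspace of $\ell^2(E)$, let $u\in H^\perp$ be a unit vector, and let $H'$ be the span of $H$ and $u$. If $\mu$ is any monotone coupling of $\mathbf P^H$ and $\mathbf P^{H'}$, then for every event $\mathcal A\subseteq 2^E$, $$\mu\{(B,B'): B'\setminus B\in\mathcal A\}=\mathbf P^u(\mathcal A),$$ where $\mathbf P^u$ is the law of the random singleton $\{e\}$ in which $e\in E$ is chosen with probability $|u(e)|^2$. -/

import Mathlib

open MeasureTheory

/-- The Hilbert space `ℓ²(E)` over `𝕜` (the real or complex numbers). -/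
abbrev EllTwo (𝕜 : Type*) [RCLike 𝕜] (E : Type*) : Type _ := lp (fun _ : E => 𝕜) 2

open Classical in
/-- The matrix of the orthogonal projection `P_K` of `ℓ²(E)` onto `K` in the standard orthonormal
basis: its `(e, f)` entry is the `e`-th coordinate of `P_K 1_f`. -/
noncomputable def projMatrix {𝕜 : Type*} [RCLike 𝕜] {E : Type*}
    (K : Submodule 𝕜 (EllTwo 𝕜 E)) [K.HasOrthogonalProjection] : Matrix E E 𝕜 :=
  Matrix.of fun e f => (K.starProjection (lp.single 2 f (1 : 𝕜)) : EllTwo 𝕜 E) e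

open Classical in
/-- `P` is the determinantal probability measure `P^K` on `2^E` of the closed subspace `K`:
for every finite `A ⊆ E`, the random set contains `A` with probability equal to the minor of the
matrix of `P_K` with rows and columns in `A`. Here `2^E` carries the product σ-algebra. There is
at most one such measure, see `IsDetMeasure.unique`. -/
structure IsDetMeasure {𝕜 : Type*} [RCLike 𝕜] {E : Type*}
    (K : Submodule 𝕜 (EllTwo 𝕜 E)) [K.HasOrthogonalProjection] (P : Measure (Set E)) : Prop where
  isProbabilityMeasure : IsProbabilityMeasure P
  prob_superset : ∀ A : Finset E,
    ((P.real {B : Set E | (A : Set E) ⊆ B} : ℝ) : 𝕜) =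
      ((projMatrix K).submatrix (fun e : A => (e : E)) (fun e : A => (e : E))).det

/-- `μ` is a monotone coupling of the measures `P` and `P'` on `2^E`. -/
structure IsMonotoneCoupling {E : Type*} (μ : Measure (Set E × Set E))
    (P P' : Measure (Set E)) : Prop where
  isProbabilityMeasure : IsProbabilityMeasure μ
  map_fst : μ.map Prod.fst = P
  map_snd : μ.map Prod.snd = P'
  ae_subset : ∀ᵐ p ∂μ, p.1 ⊆ p.2

/-- The codimension of `K` in `K'` (for `K ≤ K'`), as an element of `ℕ ∪ {∞}`. -/
noncomputable def codimIn {𝕜 : Type*} [RCLike 𝕜] {V : Type*} [AddCommGroup V] [Module 𝕜 V]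
    (K K' : Submodule 𝕜 V) : ℕ∞ :=
  Cardinal.toENat (Module.rank 𝕜 (K' ⧸ K.submoduleOf K'))

/-- The measure `P^u` on `2^E` of a unit vector `u ∈ ℓ²(E)`: the law of the random singleton `{e}`,
where `e ∈ E` is chosen with probability `|u(e)|²`. -/
noncomputable def unitVecMeasure {𝕜 : Type*} [RCLike 𝕜] {E : Type*} (u : EllTwo 𝕜 E) :
    Measure (Set E) :=
  Measure.sum fun e : E => ENNReal.ofReal (‖u e‖ ^ 2) • Measure.dirac ({e} : Set E)

theorem measurableSet_mem_set {E : Type*} (e : E) : MeasurableSet {B : Set E | e ∈ B} :=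
  measurableSet_setOfPred.2 (measurable_set_mem e)

theorem IsDetMeasure.unique {𝕜 : Type*} [RCLike 𝕜] {E : Type*}
    {K : Submodule 𝕜 (EllTwo 𝕜 E)} [K.HasOrthogonalProjection] {P P' : Measure (Set E)}
    (h : IsDetMeasure K P) (h' : IsDetMeasure K P') : P = P' := by
  classical
  have := h.isProbabilityMeasure
  have := h'.isProbabilityMeasure
  refine ext_of_generate_finite {S | ∃ A : Finset E, S = {B : Set E | (A : Set E) ⊆ B}}
    ?_ ?_ ?_ (by simp)
  · apply le_antisymm
    · refine iSup_le fun e => measurable_iff_comap_le.1 ?_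
      refine @measurable_to_prop (Set E) (MeasurableSpace.generateFrom _) (fun B => e ∈ B) ?_
      refine MeasurableSpace.measurableSet_generateFrom ⟨{e}, ?_⟩
      ext B
      simp
    · refine MeasurableSpace.generateFrom_le ?_
      rintro _ ⟨A, rfl⟩
      have : {B : Set E | (A : Set E) ⊆ B} = ⋂ e ∈ A, {B : Set E | e ∈ B} := by
        ext B; simp [Set.subset_def]
      rw [this]
      exact A.measurableSet_biInter fun e _ => measurableSet_mem_set e
  · rintro _ ⟨A, rfl⟩ _ ⟨A', rfl⟩ _
    refine ⟨A ∪ A', ?_⟩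
    ext B
    simp
  · rintro _ ⟨A, rfl⟩
    have := (h.prob_superset A).trans (h'.prob_superset A).symm
    have := RCLike.ofReal_injective this
    simpa [Measure.real, ENNReal.toReal_eq_toReal_iff'] using this

/-! ### Contraction of antisymmetric functions on a finite set -/

section FiniteContraction

variable {𝕜 : Type*} [RCLike 𝕜] {E : Type*} [Fintype E] {ι : Type*} [DecidableEq ι]

/-! For an orthonormal family `v` of size `d` the determinantal measure is explicit: the tuple `a`
has weight `‖slater v a‖ ^ 2 / d!`, and the random set is its range, which has `d` points almost
surely. The Andréief and Sylvester determinant identities give the generating function `E[(1 + t) ^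
|B ∩ A|] = det (1 + t K_A)`, whose coefficient of `t ^ |A|` is the required minor
(`IsOrthonormalFamily.isKernelMeasure`).

The core is stochastic domination when a unit vector `u` is adjoined to `v`
(`IsOrthonormalFamily.slaterMeasure_le`). Contracting the Slater function of `(u, v)` with `u` gives
back that of `v`. Cut the larger function off to the tuples whose range lies in an upper event: it
stays antisymmetric, and its contraction still equals `slater v` on the event, because adding a
point does not leave an upper set. Suitably normalised, contraction of antisymmetric functions with
a vector of norm at most one does not increase the norm (it is a fermionic annihilation operator),
and this is the inequality of probabilities. Strassen's theorem turns it into a monotone coupling.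

In any monotone coupling of this pair the two sets have `d` and `d + 1` points, so they differ by
one point, which is `e` with probability `K'(e,e) - K(e,e) = |u(e)|²`. This is part (b).

For part (a), an orthonormal basis of `H` is extended to one of `H'`. Adding one vector to an
infinite family is a limit of the finite case along an ultrafilter. A limit could lose the point of
difference at infinity, but its law is fixed along the limit and has total mass one, so exactly one
point survives (`exists_coupling_union_subsingleton`). The couplings for successive vectors are
glued into a Markov chain of increasing sets. Its union has the law belonging to `H'`, and the
disjoint increments count the codimension (`exists_coupling_univ`). -/

theorem sum_sum_update [Fintype ι] {M : Type*} [AddCommMonoid M] (φ : (ι → E) → M) (i : ι) :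
    ∑ e : ι → E, ∑ x : E, φ (Function.update e i x) = Fintype.card E • ∑ e, φ e := by
  classical
  -- The map exchanges the new value with the overwritten one, so it is its own inverse.
  have hinv : Function.Involutive
      (fun p : (ι → E) × E => (Function.update p.1 i p.2, p.1 i)) := by
    rintro ⟨e, x⟩
    simp
  rw [← Fintype.sum_prod_type']
  have h := Equiv.sum_comp hinv.toPerm (fun p : (ι → E) × E => φ p.1)
  rw [Fintype.sum_prod_type (fun p : (ι → E) × E => φ p.1)] at h
  simpa [Finset.smul_sum] using h

/-- The contraction of `g` in the `i`-th variable by `u`. -/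
noncomputable def contractAt (u : E → 𝕜) (g : (ι → E) → 𝕜) (i : ι) (e : ι → E) : 𝕜 :=
  ∑ x, star (u x) * g (Function.update e i x)

@[simp]
theorem contractAt_update (u : E → 𝕜) (g : (ι → E) → 𝕜) (i : ι) (e : ι → E) (x : E) :
    contractAt u g i (Function.update e i x) = contractAt u g i e := by
  simp [contractAt]

theorem update_comp_swap {E : Type*} (e : ι → E) (i j : ι) (x : E) :
    Function.update e j x ∘ Equiv.swap i j = Function.update (e ∘ Equiv.swap i j) i x := by
  rw [Function.update_comp_equiv]
  simp

/-- Contracting twice with the same vector pairs a symmetric weight in `(x, y)` with an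
antisymmetric function. -/
theorem sum_contractAt_eq_zero {u : E → 𝕜} {g : (ι → E) → 𝕜}
    (hg : ∀ i j, i ≠ j → ∀ e, g (e ∘ Equiv.swap i j) = -g e) {i j : ι} (hij : i ≠ j) (e : ι → E) :
    ∑ x, star (u x) * contractAt u g i (Function.update e j x) = 0 := by
  have key : ∀ x y, g (Function.update (Function.update e j y) i x)
      = -g (Function.update (Function.update e j x) i y) := by
    intro x y
    rw [← hg i j hij]
    congr 1
    ext k
    by_cases hki : k = i
    · subst hki; simp [hij.symm]
    by_cases hkj : k = j
    · subst hkj; simp [hij.symm]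
    · simp [Equiv.swap_apply_of_ne_of_ne hki hkj, hki, hkj]
  have h : ∑ x, star (u x) * contractAt u g i (Function.update e j x)
      = -∑ x, star (u x) * contractAt u g i (Function.update e j x) := by
    simp only [contractAt, Finset.mul_sum]
    conv_lhs => rw [Finset.sum_comm]
    simp only [← Finset.sum_neg_distrib]
    refine Finset.sum_congr rfl fun x _ => Finset.sum_congr rfl fun y _ => ?_
    rw [key]
    ring
  exact self_eq_neg.1 h

variable [Fintype ι]

theorem sum_norm_contractAt_sq_eq {u : E → 𝕜} {g : (ι → E) → 𝕜}
    (hg : ∀ i j, i ≠ j → ∀ e, g (e ∘ Equiv.swap i j) = -g e) (i j : ι) :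
    ∑ e, ‖contractAt u g i e‖ ^ 2 = ∑ e, ‖contractAt u g j e‖ ^ 2 := by
  rcases eq_or_ne i j with rfl | hij
  · rfl
  refine (Fintype.sum_equiv (Equiv.arrowCongr (Equiv.swap i j) (Equiv.refl E)) _ _ fun e => ?_).symm
  have : contractAt u g i (e ∘ Equiv.swap i j) = -contractAt u g j e := by
    simp only [contractAt, ← Finset.sum_neg_distrib, ← update_comp_swap, hg i j hij, mul_neg]
  have h2 : (Equiv.arrowCongr (Equiv.swap i j) (Equiv.refl E)) e = e ∘ Equiv.swap i j := by
    ext k; simp [Equiv.arrowCongr]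
  rw [h2, this, norm_neg]

/-- The functions `h i` below are mutually orthogonal; `card E * ⟪h i, g⟫` equals the `i`-th sum on
the left, and `card E * ‖h i‖ ^ 2` is at most that sum. Expanding `0 ≤ ‖∑ h i - g‖ ^ 2` gives the
bound. The factor `card E` appears because a contraction does not depend on its `i`-th argument. -/
theorem sum_norm_contractAt_sq_le {u : E → 𝕜} (hu : ∑ x, ‖u x‖ ^ 2 ≤ 1) {g : (ι → E) → 𝕜}
    (hg : ∀ i j, i ≠ j → ∀ e, g (e ∘ Equiv.swap i j) = -g e) :
    ∑ i, ∑ e, ‖contractAt u g i e‖ ^ 2 ≤ Fintype.card E * ∑ e, ‖g e‖ ^ 2 := by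
  classical
  rcases isEmpty_or_nonempty E with hE | hE
  · simp [contractAt]
  have hcard : (0 : ℝ) < Fintype.card E := by exact_mod_cast Fintype.card_pos
  have hcard' : (Fintype.card E : 𝕜) ≠ 0 := by exact_mod_cast hcard.ne'
  let G : EuclideanSpace 𝕜 (ι → E) := WithLp.toLp 2 g
  let h : ι → EuclideanSpace 𝕜 (ι → E) := fun i =>
    WithLp.toLp 2 fun e => u (e i) * contractAt u g i e
  have hA : ∀ i, (Fintype.card E : 𝕜) * inner 𝕜 (h i) G
      = ((∑ e, ‖contractAt u g i e‖ ^ 2 : ℝ) : 𝕜) := by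
    intro i
    simp only [PiLp.inner_apply, RCLike.inner_apply]
    rw [← nsmul_eq_mul, ← sum_sum_update _ i]
    push_cast
    refine Finset.sum_congr rfl fun e _ => ?_
    simp only [h, G, Function.update_self, contractAt_update, map_mul]
    rw [← RCLike.mul_conj, mul_comm]
    conv_rhs => enter [2]; rw [contractAt]
    rw [Finset.mul_sum]
    refine Finset.sum_congr rfl fun x _ => ?_
    simp only [RCLike.star_def]
    ring
  have hB : ∀ i, (Fintype.card E : ℝ) * ‖h i‖ ^ 2 ≤ ∑ e, ‖contractAt u g i e‖ ^ 2 := by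
    intro i
    rw [EuclideanSpace.norm_sq_eq, ← nsmul_eq_mul, ← sum_sum_update _ i]
    refine Finset.sum_le_sum fun e _ => ?_
    simp only [h, Function.update_self, contractAt_update, norm_mul, mul_pow]
    rw [← Finset.sum_mul]
    exact mul_le_of_le_one_left (by positivity) hu
  have hC : ∀ i j, i ≠ j → inner 𝕜 (h j) (h i) = 0 := by
    intro i j hij
    refine (mul_eq_zero.1 (?_ : (Fintype.card E : 𝕜) * inner 𝕜 (h j) (h i) = 0)).resolve_left hcard'
    simp only [PiLp.inner_apply, RCLike.inner_apply]
    rw [← nsmul_eq_mul, ← sum_sum_update _ j]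
    refine Finset.sum_eq_zero fun e _ => ?_
    have := sum_contractAt_eq_zero hg hij e (u := u)
    simp only [h, Function.update_self, contractAt_update, map_mul, ne_eq, hij,
      not_false_eq_true, Function.update_of_ne]
    calc _ = u (e i) * star (contractAt u g j e) *
          ∑ x, star (u x) * contractAt u g i (Function.update e j x) := by
          rw [Finset.mul_sum]
          refine Finset.sum_congr rfl fun x _ => ?_
          simp only [RCLike.star_def]
          ring
      _ = 0 := by rw [this, mul_zero]
  have hsum : ‖∑ i, h i‖ ^ 2 = ∑ i, ‖h i‖ ^ 2 := by
    rw [← RCLike.ofReal_inj (K := 𝕜)]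
    push_cast
    simp only [← inner_self_eq_norm_sq_to_K (𝕜 := 𝕜)]
    rw [sum_inner]
    refine Finset.sum_congr rfl fun i _ => ?_
    rw [inner_sum, Finset.sum_eq_single i (fun j _ hj => hC j i hj) (by simp)]
  have hA' : ∀ i, Fintype.card E * RCLike.re (inner 𝕜 (h i) G)
      = ∑ e, ‖contractAt u g i e‖ ^ 2 := by
    intro i
    have := congrArg RCLike.re (hA i)
    rw [RCLike.ofReal_re] at this
    rw [← this, ← nsmul_eq_mul, ← nsmul_eq_mul, map_nsmul]
  have hexp := norm_sub_sq (𝕜 := 𝕜) (∑ i, h i) G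
  rw [hsum, sum_inner, map_sum] at hexp
  have hG : ‖G‖ ^ 2 = ∑ e, ‖g e‖ ^ 2 := EuclideanSpace.norm_sq_eq _
  have h0 : 0 ≤ Fintype.card E * ‖∑ i, h i - G‖ ^ 2 := by positivity
  rw [hexp] at h0
  have hB' := Finset.sum_le_sum fun i (_ : i ∈ Finset.univ) => hB i
  rw [← Finset.mul_sum] at hB'
  have hA'' : Fintype.card E * ∑ i, RCLike.re (inner 𝕜 (h i) G)
      = ∑ i, ∑ e, ‖contractAt u g i e‖ ^ 2 := by
    rw [Finset.mul_sum]; exact Finset.sum_congr rfl fun i _ => hA' i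
  rw [← hG]
  nlinarith

/-- Contracting an antisymmetric function of `d + 1` variables with a vector of norm at most one. -/
theorem sum_norm_contract_sq_le {d : ℕ} {u : E → 𝕜} (hu : ∑ x, ‖u x‖ ^ 2 ≤ 1)
    {g : (Fin (d + 1) → E) → 𝕜}
    (hg : ∀ i j, i ≠ j → ∀ e, g (e ∘ Equiv.swap i j) = -g e) :
    (d + 1) * ∑ a : Fin d → E, ‖∑ x, star (u x) * g (Fin.cons x a)‖ ^ 2 ≤ ∑ e, ‖g e‖ ^ 2 := by
  rcases isEmpty_or_nonempty E with hE | hE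
  · simp only [Finset.univ_eq_empty, Finset.sum_empty, norm_zero]
    norm_num
  have hcard : (0 : ℝ) < Fintype.card E := by exact_mod_cast Fintype.card_pos
  have h := sum_norm_contractAt_sq_le hu hg
  -- By antisymmetry all `d + 1` slots contribute equally.
  simp only [fun i => sum_norm_contractAt_sq_eq hg (u := u) i 0] at h
  have h0 : ∑ e, ‖contractAt u g 0 e‖ ^ 2
      = Fintype.card E * ∑ a : Fin d → E, ‖∑ x, star (u x) * g (Fin.cons x a)‖ ^ 2 := by
    rw [← Fintype.sum_equiv (Fin.consEquiv fun _ : Fin (d + 1) => E)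
      (fun p => ‖contractAt u g 0 (Fin.cons p.1 p.2)‖ ^ 2) _ (fun p => rfl), Fintype.sum_prod_type]
    simp [contractAt]
  rw [h0] at h
  simp only [Finset.sum_const, Finset.card_univ, Fintype.card_fin, nsmul_eq_mul] at h
  push_cast at h
  refine le_of_mul_le_mul_left ?_ hcard
  linarith

end FiniteContraction

/-! ### Slater determinants and the generating function -/

section SlaterDeterminant

open Filter Topology

variable {𝕜 : Type*} [RCLike 𝕜] {E : Type*} {d : ℕ}

/-- The Slater determinant of the functions `v i` at the points `a j`. -/
noncomputable def slater (v : Fin d → E → 𝕜) (a : Fin d → E) : 𝕜 :=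
  (Matrix.of fun i j => v i (a j)).det

theorem slater_comp_perm (v : Fin d → E → 𝕜) (a : Fin d → E) (σ : Equiv.Perm (Fin d)) :
    slater v (a ∘ σ) = (Equiv.Perm.sign σ : ℤ) * slater v a :=
  Matrix.det_permute' σ (Matrix.of fun i j => v i (a j))

theorem injective_of_slater_ne_zero {v : Fin d → E → 𝕜} {a : Fin d → E} (h : slater v a ≠ 0) :
    Function.Injective a := by
  intro i j hij
  by_contra hne
  exact h (Matrix.det_zero_of_column_eq hne fun k => by simp [hij])

/-- Andréief (Cauchy–Binet) identity. Expand one determinant; relabelling the tuple by `σ` makes all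
`d!` terms equal, the sign being absorbed by the other determinant. Expanding that one, the sum
factors over coordinates. -/
theorem sum_prod_mul_slater_mul_star (v : Fin d → E → 𝕜) (φ : E → 𝕜) (F : Finset E) :
    ∑ a ∈ Fintype.piFinset (fun _ : Fin d => F), (∏ j, φ (a j)) * (slater v a * star (slater v a))
      = d.factorial * (Matrix.of fun i j => ∑ e ∈ F, φ e * (v i e * star (v j e))).det := by
  classical
  have h1 : ∀ σ : Equiv.Perm (Fin d),
      ∑ a ∈ Fintype.piFinset (fun _ : Fin d => F), (∏ j, φ (a j)) *
        (((Equiv.Perm.sign σ : ℤ) * ∏ j, v (σ j) (a j)) * star (slater v a)) =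
      ∑ a ∈ Fintype.piFinset (fun _ : Fin d => F), (∏ j, φ (a j)) *
        ((∏ j, v j (a j)) * star (slater v a)) := by
    intro σ
    refine Finset.sum_equiv (Equiv.arrowCongr σ (Equiv.refl E)) ?_ ?_
    · intro a
      simp only [Fintype.mem_piFinset, Equiv.arrowCongr_apply, Equiv.coe_refl, Function.comp_apply,
        id_eq]
      exact ⟨fun h i => h _, fun h i => by simpa using h (σ i)⟩
    · intro a _
      have ha : (Equiv.arrowCongr σ (Equiv.refl E)) a = a ∘ (σ⁻¹ : Equiv.Perm (Fin d)) := by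
        ext k; simp [Equiv.arrowCongr]
      rw [ha, slater_comp_perm]
      have e1 : ∏ j, φ ((a ∘ (σ⁻¹ : Equiv.Perm (Fin d))) j) = ∏ j, φ (a j) :=
        Equiv.prod_comp (σ⁻¹ : Equiv.Perm (Fin d)) fun j => φ (a j)
      have e2 : ∏ j, v (σ j) (a j) = ∏ j, v j ((a ∘ (σ⁻¹ : Equiv.Perm (Fin d))) j) := by
        rw [← Equiv.prod_comp σ fun j => v j ((a ∘ (σ⁻¹ : Equiv.Perm (Fin d))) j)]
        simp
      rw [e1, e2]
      simp only [star_mul', Equiv.Perm.sign_inv, star_intCast]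
      ring
  have h2 : ∀ a : Fin d → E, slater v a
      = ∑ σ : Equiv.Perm (Fin d), ((Equiv.Perm.sign σ : ℤ) : 𝕜) * ∏ j, v (σ j) (a j) := by
    intro a
    rw [slater, Matrix.det_apply']
    rfl
  calc _ = ∑ σ : Equiv.Perm (Fin d), ∑ a ∈ Fintype.piFinset (fun _ : Fin d => F),
        (∏ j, φ (a j)) * (((Equiv.Perm.sign σ : ℤ) * ∏ j, v (σ j) (a j)) * star (slater v a)) := by
        rw [Finset.sum_comm]
        refine Finset.sum_congr rfl fun a _ => ?_
        conv_lhs => enter [2, 1]; rw [h2]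
        rw [Finset.sum_mul, Finset.mul_sum]
    _ = d.factorial * ∑ a ∈ Fintype.piFinset (fun _ : Fin d => F), (∏ j, φ (a j)) *
        ((∏ j, v j (a j)) * star (slater v a)) := by
        rw [Finset.sum_congr rfl fun σ _ => h1 σ]
        simp [Finset.card_univ, Fintype.card_perm]
    _ = _ := by
        congr 1
        rw [← Matrix.det_transpose, Matrix.det_apply']
        simp only [Matrix.transpose_apply, Matrix.of_apply, Finset.prod_univ_sum]
        simp only [Finset.mul_sum]
        rw [Finset.sum_comm]
        refine Finset.sum_congr rfl fun a _ => ?_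
        rw [h2, star_sum, Finset.mul_sum, Finset.mul_sum]
        refine Finset.sum_congr rfl fun σ _ => ?_
        simp only [star_mul', star_prod, Finset.prod_mul_distrib, star_intCast]
        ring

/-- Boxes `F ^ d` are cofinal among finite sets of tuples, so for nonnegative terms the limit along
boxes is the sum. -/
theorem hasSum_of_tendsto_sum_piFinset {ψ : (Fin d → E) → ℝ} (h0 : ∀ a, 0 ≤ ψ a) {L : ℝ}
    (h : Tendsto (fun F : Finset E => ∑ a ∈ Fintype.piFinset (fun _ : Fin d => F), ψ a)
      atTop (𝓝 L)) : HasSum ψ L := by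
  classical
  have hmono : Monotone fun F : Finset E => ∑ a ∈ Fintype.piFinset (fun _ : Fin d => F), ψ a :=
    fun F F' hF => Finset.sum_le_sum_of_subset_of_nonneg
      (Fintype.piFinset_subset _ _ fun _ => hF) fun a _ _ => h0 a
  refine hasSum_of_isLUB_of_nonneg L h0 ⟨?_, ?_⟩
  · rintro _ ⟨S, rfl⟩
    refine le_trans ?_ (hmono.ge_of_tendsto h (S.biUnion fun a => Finset.univ.image a))
    refine Finset.sum_le_sum_of_subset_of_nonneg ?_ fun a _ _ => h0 a
    intro a ha
    simp only [Fintype.mem_piFinset, Finset.mem_biUnion, Finset.mem_image]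
    exact fun j => ⟨a, ha, j, by simp, rfl⟩
  · intro b hb
    exact le_of_tendsto' h fun F => hb ⟨_, rfl⟩

/-- The functions `v i` are square summable and orthonormal. -/
def IsOrthonormalFamily {J : Type*} [DecidableEq J] (v : J → E → 𝕜) : Prop :=
  ∀ i j, HasSum (fun e => v i e * star (v j e)) (if i = j then 1 else 0)

/-- The kernel of the projection onto the span of the orthonormal functions `v i`. -/
noncomputable def familyKernel (v : Fin d → E → 𝕜) : Matrix E E 𝕜 :=
  Matrix.of fun e f => ∑ i, v i e * star (v i f)

/-- The Andréief identity with weight `1 + t 1_A`, on larger and larger boxes: the Gram matrix tends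
to `1 + t V Vᴴ`, and Sylvester's identity moves the determinant from `Fin d` to `A`. -/
theorem IsOrthonormalFamily.hasSum_prod_mul_norm_slater {v : Fin d → E → 𝕜}
    (hv : IsOrthonormalFamily v) (A : Finset E) [DecidableEq E] {t : ℝ} (ht : 0 ≤ t) :
    ∃ r : ℝ, HasSum (fun a : Fin d → E =>
        (∏ j, (1 + if a j ∈ A then t else 0)) * (‖slater v a‖ ^ 2 / d.factorial)) r ∧
      (r : 𝕜) = (1 + (t : 𝕜) • (familyKernel v).submatrix
        (fun e : A => (e : E)) (fun e : A => (e : E))).det := by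
  set ψ : (Fin d → E) → ℝ := fun a =>
    (∏ j, (1 + if a j ∈ A then t else 0)) * (‖slater v a‖ ^ 2 / d.factorial) with hψ
  have h0 : ∀ a, 0 ≤ ψ a := fun a => by
    refine mul_nonneg (Finset.prod_nonneg fun j _ => ?_) (by positivity)
    split_ifs <;> linarith
  let φ : E → 𝕜 := fun e => 1 + if e ∈ A then (t : 𝕜) else 0
  have hfac : (d.factorial : 𝕜) ≠ 0 := by exact_mod_cast d.factorial_ne_zero
  have hF : ∀ F : Finset E, ((∑ a ∈ Fintype.piFinset (fun _ : Fin d => F), ψ a : ℝ) : 𝕜)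
      = (Matrix.of fun i j => ∑ e ∈ F, φ e * (v i e * star (v j e))).det := by
    intro F
    have := sum_prod_mul_slater_mul_star v φ F
    rw [← mul_right_inj' hfac, ← this, RCLike.ofReal_sum, Finset.mul_sum]
    refine Finset.sum_congr rfl fun a _ => ?_
    simp only [hψ, φ, RCLike.star_def, RCLike.mul_conj]
    push_cast [apply_ite (RCLike.ofReal : ℝ → 𝕜)]
    field_simp
  have hG : ∀ i j, HasSum (fun e => φ e * (v i e * star (v j e)))
      ((if i = j then 1 else 0) + t * ∑ e ∈ A, v i e * star (v j e)) := by
    intro i j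
    have h1 : HasSum (fun e => if e ∈ A then (t : 𝕜) * (v i e * star (v j e)) else 0)
        (t * ∑ e ∈ A, v i e * star (v j e)) := by
      rw [Finset.mul_sum]
      have : HasSum (fun e => if e ∈ A then (t : 𝕜) * (v i e * star (v j e)) else 0)
          (∑ e ∈ A, if e ∈ A then (t : 𝕜) * (v i e * star (v j e)) else 0) :=
        hasSum_sum_of_ne_finset_zero fun e he => by simp [he]
      rwa [Finset.sum_congr rfl fun e he => if_pos he] at this
    convert (hv i j).add h1 using 1
    ext e
    simp only [φ]
    split_ifs <;> ring
  set V : Matrix (Fin d) A 𝕜 := Matrix.of fun i e => v i e with hV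
  have hdet : (Matrix.of fun i j => (if i = j then (1 : 𝕜) else 0)
      + t * ∑ e ∈ A, v i e * star (v j e)).det = (1 + (t : 𝕜) • (familyKernel v).submatrix
        (fun e : A => (e : E)) (fun e : A => (e : E))).det := by
    have e1 : (Matrix.of fun i j => (if i = j then (1 : 𝕜) else 0)
        + t * ∑ e ∈ A, v i e * star (v j e)) = 1 + ((t : 𝕜) • V) * V.conjTranspose := by
      ext i j
      simp only [Matrix.of_apply, Matrix.add_apply, Matrix.one_apply, hV, Matrix.mul_apply,
        Matrix.smul_apply, Matrix.conjTranspose_apply, smul_eq_mul, mul_assoc, ← Finset.mul_sum]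
      rw [Finset.sum_coe_sort A fun e => v i e * star (v j e)]
    have e2 : (1 + (t : 𝕜) • (familyKernel v).submatrix (fun e : A => (e : E))
        (fun e : A => (e : E))) = (1 + V.conjTranspose * ((t : 𝕜) • V)).transpose := by
      ext e f
      simp only [familyKernel, Matrix.add_apply, Matrix.one_apply, Matrix.smul_apply,
        Matrix.submatrix_apply, Matrix.of_apply, smul_eq_mul, Matrix.mul_smul,
        Matrix.transpose_apply, Matrix.mul_apply, hV, Matrix.conjTranspose_apply, eq_comm (a := e)]
      congr 2
      exact Finset.sum_congr rfl fun i _ => mul_comm _ _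
    rw [e1, e2, Matrix.det_transpose, Matrix.det_one_add_mul_comm]
  have hlim : Tendsto (fun F : Finset E =>
      ((∑ a ∈ Fintype.piFinset (fun _ : Fin d => F), ψ a : ℝ) : 𝕜)) atTop
      (𝓝 (1 + (t : 𝕜) • (familyKernel v).submatrix
        (fun e : A => (e : E)) (fun e : A => (e : E))).det) := by
    rw [← hdet]
    simp only [hF]
    refine ((Continuous.matrix_det continuous_id).tendsto _).comp ?_
    refine tendsto_pi_nhds.2 fun i => tendsto_pi_nhds.2 fun j => ?_
    exact hG i j
  have hre := (RCLike.continuous_re.tendsto _).comp hlim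
  simp only [Function.comp_def, RCLike.ofReal_re] at hre
  refine ⟨_, hasSum_of_tendsto_sum_piFinset h0 hre, ?_⟩
  exact tendsto_nhds_unique ((RCLike.continuous_ofReal.tendsto _).comp hre) hlim

end SlaterDeterminant

/-! ### The determinantal measure of a finite orthonormal family -/

section DeterminantalMeasure

open Filter Topology

variable {𝕜 : Type*} [RCLike 𝕜] {E : Type*} {d : ℕ}

open Classical in
/-- `P` is the determinantal probability measure with kernel `M`. -/
structure IsKernelMeasure (M : Matrix E E 𝕜) (P : Measure (Set E)) : Prop where
  isProbabilityMeasure : IsProbabilityMeasure P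
  prob_superset : ∀ A : Finset E,
    ((P.real {B : Set E | (A : Set E) ⊆ B} : ℝ) : 𝕜) =
      (M.submatrix (fun e : A => (e : E)) (fun e : A => (e : E))).det

theorem measurableSet_superset (A : Finset E) : MeasurableSet {B : Set E | (A : Set E) ⊆ B} := by
  have : {B : Set E | (A : Set E) ⊆ B} = ⋂ e ∈ A, {B : Set E | e ∈ B} := by
    ext B; simp [Set.subset_def]
  rw [this]
  exact A.measurableSet_biInter fun e _ => measurableSet_mem_set e

/-- The determinantal measure of an orthonormal family: the law of the set of points of a random
tuple whose density is the normalized squared Slater determinant. -/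
noncomputable def slaterMeasure (v : Fin d → E → 𝕜) : Measure (Set E) :=
  Measure.sum fun a : Fin d → E =>
    ENNReal.ofReal (‖slater v a‖ ^ 2 / d.factorial) • Measure.dirac (Set.range a)

theorem IsOrthonormalFamily.hasSum_norm_slater {v : Fin d → E → 𝕜} (hv : IsOrthonormalFamily v) :
    HasSum (fun a : Fin d → E => ‖slater v a‖ ^ 2 / d.factorial) 1 := by
  classical
  obtain ⟨r, hr, hr'⟩ := hv.hasSum_prod_mul_norm_slater ∅ le_rfl
  have : r = 1 := by
    rw [← RCLike.ofReal_inj (K := 𝕜), hr']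
    simp
  rw [this] at hr
  simpa using hr

theorem IsOrthonormalFamily.hasSum_slaterMeasure {v : Fin d → E → 𝕜} (hv : IsOrthonormalFamily v)
    {S : Set (Set E)} (hS : MeasurableSet S) :
    HasSum (fun a : Fin d → E => ‖slater v a‖ ^ 2 / d.factorial *
      S.indicator 1 (Set.range a)) ((slaterMeasure v).real S) := by
  have h0 : ∀ a : Fin d → E, 0 ≤ ‖slater v a‖ ^ 2 / d.factorial * S.indicator 1 (Set.range a) :=
    fun a => mul_nonneg (by positivity) (Set.indicator_nonneg (by simp) _)
  have hs : Summable fun a : Fin d → E => ‖slater v a‖ ^ 2 / d.factorial *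
      S.indicator 1 (Set.range a) := by
    refine hv.hasSum_norm_slater.summable.of_nonneg_of_le h0 fun a => ?_
    refine mul_le_of_le_one_right (by positivity) ?_
    exact Set.indicator_apply_le' (by simp) (by simp)
  convert hs.hasSum using 1
  rw [measureReal_def, slaterMeasure, Measure.sum_apply _ hS,
    ← ENNReal.toReal_ofReal (tsum_nonneg h0), ENNReal.ofReal_tsum_of_nonneg h0 hs]
  congr 1
  refine tsum_congr fun a => ?_
  rw [ENNReal.ofReal_mul (by positivity), Measure.smul_apply, Measure.dirac_apply' _ hS,
    smul_eq_mul]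
  congr 1
  by_cases h : Set.range a ∈ S <;> simp [h]

theorem IsOrthonormalFamily.isProbabilityMeasure {v : Fin d → E → 𝕜}
    (hv : IsOrthonormalFamily v) : IsProbabilityMeasure (slaterMeasure v) := by
  constructor
  have h := hv.hasSum_norm_slater
  rw [slaterMeasure, Measure.sum_apply _ MeasurableSet.univ]
  simp only [Measure.smul_apply, measure_univ, smul_eq_mul, mul_one]
  rw [← ENNReal.ofReal_tsum_of_nonneg (fun a => by positivity) h.summable, h.tsum_eq,
    ENNReal.ofReal_one]

theorem card_filter_mem_le {a : Fin d → E} (ha : Function.Injective a) (A : Finset E)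
    [DecidableEq E] : (Finset.univ.filter fun j => a j ∈ A).card ≤ A.card :=
  Finset.card_le_card_of_injOn a (fun j hj => by simpa using hj) ha.injOn

theorem card_filter_mem_eq_iff {a : Fin d → E} (ha : Function.Injective a) (A : Finset E)
    [DecidableEq E] :
    (Finset.univ.filter fun j => a j ∈ A).card = A.card ↔ (A : Set E) ⊆ Set.range a := by
  have himg : ((Finset.univ.filter fun j => a j ∈ A).image a).card
      = (Finset.univ.filter fun j => a j ∈ A).card := Finset.card_image_of_injective _ ha
  have hsub : (Finset.univ.filter fun j => a j ∈ A).image a ⊆ A := by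
    intro e he
    simp only [Finset.mem_image, Finset.mem_filter] at he
    obtain ⟨j, hj, rfl⟩ := he
    exact hj.2
  rw [← himg]
  constructor
  · intro h e he
    rw [Finset.mem_coe, ← Finset.eq_of_subset_of_card_le hsub h.ge] at he
    simp only [Finset.mem_image] at he
    obtain ⟨j, -, hj⟩ := he
    exact ⟨j, hj⟩
  · intro h
    congr 1
    refine hsub.antisymm fun e he => ?_
    obtain ⟨j, rfl⟩ := h he
    simpa using ⟨j, he, rfl⟩

/-- Put `t = 1 / s` in the generating function and multiply by `s ^ |A|`: the weighted sum of `(s +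
1) ^ c * s ^ (m - c)` is `det (s + K)`. As `s → 0+`, only tuples covering `A` survive. -/
theorem IsOrthonormalFamily.isKernelMeasure {v : Fin d → E → 𝕜} (hv : IsOrthonormalFamily v) :
    IsKernelMeasure (familyKernel v) (slaterMeasure v) := by
  classical
  refine ⟨hv.isProbabilityMeasure, fun A => ?_⟩
  set K := (familyKernel v).submatrix (fun e : A => (e : E)) (fun e : A => (e : E)) with hK
  set m := A.card with hm
  let c : (Fin d → E) → ℕ := fun a => (Finset.univ.filter fun j => a j ∈ A).card
  set w : (Fin d → E) → ℝ := fun a => ‖slater v a‖ ^ 2 / d.factorial with hw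
  have hw0 : ∀ a, 0 ≤ w a := fun a => by positivity
  let q : ℝ → (Fin d → E) → ℝ := fun s a => (s + 1) ^ c a * s ^ (m - c a) * w a
  -- A tuple with repetitions may have `c a > m`, where the truncated `m - c a` is the wrong
  -- exponent; its weight vanishes.
  have hinj : ∀ a, w a ≠ 0 → Function.Injective a := by
    intro a ha
    refine injective_of_slater_ne_zero (v := v) fun h => ha ?_
    simp [hw, h]
  have hsum : ∀ s : ℝ, 0 < s → ((∑' a, q s a : ℝ) : 𝕜) = ((s : 𝕜) • 1 + K).det := by
    intro s hs
    obtain ⟨r, hr, hr'⟩ := hv.hasSum_prod_mul_norm_slater A (inv_nonneg.2 hs.le)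
    have hs' : (s : 𝕜) ≠ 0 := by exact_mod_cast hs.ne'
    have h1 : HasSum (q s) (s ^ m * r) := by
      suffices e : q s = fun a => s ^ m * ((∏ j, (1 + if a j ∈ A then s⁻¹ else 0)) *
          (‖slater v a‖ ^ 2 / d.factorial)) by
        rw [e]
        exact hr.mul_left (s ^ m)
      refine funext fun a => ?_
      by_cases ha : w a = 0
      · simp only [hw] at ha
        simp [q, hw, ha]
      have hc : c a ≤ m := card_filter_mem_le (hinj a ha) A
      have hprod : ∏ j, (1 + if a j ∈ A then s⁻¹ else 0) = (1 + s⁻¹) ^ c a := by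
        simp only [c, ← Finset.prod_const, Finset.prod_filter]
        refine Finset.prod_congr rfl fun j _ => ?_
        split_ifs <;> simp
      rw [hprod, ← mul_assoc]
      simp only [q]
      congr 1
      obtain ⟨k, hk⟩ := Nat.exists_eq_add_of_le hc
      rw [hk, Nat.add_sub_cancel_left, pow_add, mul_right_comm, ← mul_pow]
      congr 2
      field_simp
    rw [h1.tsum_eq]
    rw [RCLike.ofReal_mul, RCLike.ofReal_pow, hr']
    have : (s : 𝕜) • 1 + K = (s : 𝕜) • (1 + ((s⁻¹ : ℝ) : 𝕜) • K) := by
      rw [smul_add, smul_smul]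
      push_cast
      rw [mul_inv_cancel₀ hs', one_smul]
    rw [this, Matrix.det_smul, Fintype.card_coe]
  have hlim1 : Tendsto (fun s : ℝ => ((s : 𝕜) • (1 : Matrix A A 𝕜) + K).det) (𝓝[>] 0) (𝓝 K.det) := by
    have hcont : Continuous fun s : ℝ => ((s : 𝕜) • (1 : Matrix A A 𝕜) + K).det := by
      refine Continuous.matrix_det ?_
      refine continuous_matrix fun i j => ?_
      exact (RCLike.continuous_ofReal.mul continuous_const).add continuous_const
    have h := (hcont.tendsto 0).mono_left (nhdsWithin_le_nhds (s := Set.Ioi 0))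
    simpa using h
  have hlim2 : Tendsto (fun s : ℝ => ∑' a, q s a) (𝓝[>] 0) (𝓝 (∑' a, q 0 a)) := by
    refine tendsto_tsum_of_dominated_convergence (bound := fun a => 2 ^ m * w a)
      (hv.hasSum_norm_slater.summable.mul_left _) ?_ ?_
    · intro a
      have hcont : Continuous fun s : ℝ => q s a := by fun_prop
      exact (hcont.tendsto 0).mono_left nhdsWithin_le_nhds
    · have : Set.Ioc (0 : ℝ) 1 ∈ 𝓝[>] (0 : ℝ) := Ioc_mem_nhdsGT one_pos
      filter_upwards [this] with s hs a
      by_cases ha : w a = 0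
      · simp [q, ha]
      have hc : c a ≤ m := card_filter_mem_le (hinj a ha) A
      have hs0 := hs.1
      rw [Real.norm_of_nonneg (by positivity)]
      refine mul_le_mul_of_nonneg_right ?_ (hw0 a)
      calc (s + 1) ^ c a * s ^ (m - c a) ≤ 2 ^ c a * 1 := by
            gcongr
            · linarith [hs.2]
            · exact pow_le_one₀ hs0.le hs.2
        _ ≤ 2 ^ m := by
            rw [mul_one]
            exact pow_le_pow_right₀ one_le_two hc
  -- Since `0 ^ 0 = 1`, the factor `0 ^ (m - c a)` in `q 0` is the indicator of `c a = m`.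
  have hP : (slaterMeasure v).real {B : Set E | (A : Set E) ⊆ B} = ∑' a, q 0 a := by
    rw [← (hv.hasSum_slaterMeasure (measurableSet_superset A)).tsum_eq]
    refine tsum_congr fun a => ?_
    by_cases ha : w a = 0
    · simp only [hw] at ha
      simp [q, hw, ha]
    have hc : c a ≤ m := card_filter_mem_le (hinj a ha) A
    have hc' := card_filter_mem_eq_iff (hinj a ha) A
    rw [mul_comm]
    simp only [q]
    congr 1
    by_cases hA : (A : Set E) ⊆ Set.range a
    · have : c a = m := hc'.2 hA
      simp [hA, this]
    · have : m - c a ≠ 0 := by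
        have := mt hc'.1 hA
        change c a ≠ m at this
        omega
      simp [hA, this]
  rw [hP]
  refine tendsto_nhds_unique ((RCLike.continuous_ofReal.tendsto _).comp hlim2) (hlim1.congr' ?_)
  filter_upwards [self_mem_nhdsWithin] with s hs
  exact (hsum s hs).symm

theorem ae_encard_slaterMeasure [Countable E] (v : Fin d → E → 𝕜) :
    ∀ᵐ B ∂slaterMeasure v, B.encard = (d : ℕ∞) := by
  rw [slaterMeasure, Measure.ae_sum_iff]
  intro a
  by_cases h : slater v a = 0
  · simp [h]
  · refine Measure.ae_smul_measure ?_ _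
    rw [ae_dirac_eq]
    change (Set.range a).encard = (d : ℕ∞)
    rw [← Set.image_univ, (injective_of_slater_ne_zero h).encard_image, Set.encard_univ]
    simp

end DeterminantalMeasure

/-! ### Stochastic domination when one vector is added -/

section Domination

open Filter Topology

variable {𝕜 : Type*} [RCLike 𝕜] {E : Type*} {d : ℕ}

theorem sum_piFinset_const_eq {M : Type*} [AddCommMonoid M] {n : ℕ} (F : Finset E)
    (φ : (Fin n → E) → M) :
    ∑ b ∈ Fintype.piFinset (fun _ : Fin n => F), φ b = ∑ b : Fin n → F, φ fun i => b i := by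
  classical
  refine Finset.sum_bij' (fun b hb i => ⟨b i, Fintype.mem_piFinset.1 hb i⟩) (fun b _ i => b i)
    ?_ ?_ ?_ ?_ ?_ <;> simp

theorem IsOrthonormalFamily.hasSum_norm_sq {v : Fin d → E → 𝕜} (hv : IsOrthonormalFamily v)
    (i : Fin d) : HasSum (fun e => ‖v i e‖ ^ 2) 1 := by
  have h := hv i i
  rw [if_pos rfl] at h
  simp only [RCLike.star_def, RCLike.mul_conj] at h
  have h' := RCLike.hasSum_re 𝕜 h
  simpa only [← RCLike.ofReal_pow, RCLike.ofReal_re, RCLike.one_re] using h'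

/-- Laplace expansion along the column of the contracted point; orthonormality kills every row
except that of `u`. -/
theorem IsOrthonormalFamily.hasSum_contract_slater {u : E → 𝕜} {v : Fin d → E → 𝕜}
    (hv : IsOrthonormalFamily (Fin.cons u v : Fin (d + 1) → E → 𝕜)) (a : Fin d → E) :
    HasSum (fun e => star (u e) * slater (Fin.cons u v : Fin (d + 1) → E → 𝕜) (Fin.cons e a))
      (slater v a) := by
  have hexp : ∀ e, star (u e) * slater (Fin.cons u v : Fin (d + 1) → E → 𝕜) (Fin.cons e a)
      = ∑ i : Fin (d + 1), (-1) ^ (i : ℕ) *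
        ((Fin.cons u v : Fin (d + 1) → E → 𝕜) i e * star (u e)) *
        (Matrix.of fun k j => (Fin.cons u v : Fin (d + 1) → E → 𝕜) (i.succAbove k) (a j)).det := by
    intro e
    rw [slater, Matrix.det_succ_column_zero, Finset.mul_sum]
    refine Finset.sum_congr rfl fun i _ => ?_
    have : (Matrix.of fun i j => (Fin.cons u v : Fin (d + 1) → E → 𝕜) i
        ((Fin.cons e a : Fin (d + 1) → E) j)).submatrix i.succAbove Fin.succ =
        Matrix.of fun k j => (Fin.cons u v : Fin (d + 1) → E → 𝕜) (i.succAbove k) (a j) := by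
      ext k j
      simp
    rw [this]
    simp only [Matrix.of_apply, Fin.cons_zero]
    ring
  simp only [hexp]
  have h := hasSum_sum (s := Finset.univ) fun (i : Fin (d + 1)) _ =>
    ((hv i 0).mul_left ((-1) ^ (i : ℕ))).mul_right
    (Matrix.of fun k j => (Fin.cons u v : Fin (d + 1) → E → 𝕜) (i.succAbove k) (a j)).det
  suffices e : ∑ i : Fin (d + 1), ((-1) ^ (i : ℕ) * if i = 0 then (1 : 𝕜) else 0) *
      (Matrix.of fun k j => (Fin.cons u v : Fin (d + 1) → E → 𝕜) (i.succAbove k) (a j)).det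
      = slater v a from e ▸ h
  rw [Finset.sum_eq_single 0 (by intro i _ hi; simp [hi]) (by simp)]
  simp [slater]

theorem range_comp_equiv_swap {n : ℕ} (b : Fin n → E) (i j : Fin n) :
    Set.range (b ∘ Equiv.swap i j) = Set.range b :=
  (Equiv.swap i j).surjective.range_comp b

/-- Adding a vector to an orthonormal family increases the determinantal measure stochastically. -/
theorem IsOrthonormalFamily.slaterMeasure_le {u : E → 𝕜} {v : Fin d → E → 𝕜}
    (hv : IsOrthonormalFamily v)
    (huv : IsOrthonormalFamily (Fin.cons u v : Fin (d + 1) → E → 𝕜))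
    {𝒜 : Set (Set E)} (hup : IsUpperSet 𝒜) (hm : MeasurableSet 𝒜) :
    (slaterMeasure v).real 𝒜
      ≤ (slaterMeasure (Fin.cons u v : Fin (d + 1) → E → 𝕜)).real 𝒜 := by
  classical
  set v' : Fin (d + 1) → E → 𝕜 := Fin.cons u v with hv'
  -- The cutoff depends on the range only, so antisymmetry is kept.
  set g : (Fin (d + 1) → E) → 𝕜 := fun b => if Set.range b ∈ 𝒜 then slater v' b else 0 with hg
  have hanti : ∀ i j, i ≠ j → ∀ b, g (b ∘ Equiv.swap i j) = -g b := by
    intro i j hij b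
    simp only [hg, range_comp_equiv_swap, slater_comp_perm, Equiv.Perm.sign_swap hij]
    split_ifs <;> simp
  have hd : (0 : ℝ) < d.factorial := by exact_mod_cast d.factorial_pos
  have hg' : HasSum (fun b => ‖g b‖ ^ 2)
      ((d + 1).factorial * (slaterMeasure v').real 𝒜) := by
    have hd' : ((d + 1).factorial : ℝ) ≠ 0 := by exact_mod_cast (d + 1).factorial_ne_zero
    suffices e : (fun b => ‖g b‖ ^ 2) = fun b => ((d + 1).factorial : ℝ) *
        (‖slater v' b‖ ^ 2 / (d + 1).factorial * 𝒜.indicator 1 (Set.range b)) from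
      e ▸ (huv.hasSum_slaterMeasure hm).mul_left ((d + 1).factorial : ℝ)
    refine funext fun b => ?_
    by_cases h : Set.range b ∈ 𝒜
    · simp only [hg, h, if_true, Set.indicator_of_mem, Pi.one_apply, mul_one]
      field_simp
    · simp [hg, h]
  refine hasSum_le_of_sum_le (hv.hasSum_slaterMeasure hm) fun S => ?_
  set S' := S.filter fun a => Set.range a ∈ 𝒜 with hS'
  have h1 : ∑ a ∈ S, ‖slater v a‖ ^ 2 / d.factorial * 𝒜.indicator 1 (Set.range a)
      = (∑ a ∈ S', ‖slater v a‖ ^ 2) / d.factorial := by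
    rw [Finset.sum_div, hS', Finset.sum_filter]
    refine Finset.sum_congr rfl fun a _ => ?_
    split_ifs with h <;> simp [h]
  rw [h1]
  have hlim : Tendsto (fun F : Finset E => (d + 1) * ∑ a ∈ S',
      ‖∑ e ∈ F, star (u e) * slater v' (Fin.cons e a)‖ ^ 2) atTop
      (𝓝 ((d + 1) * ∑ a ∈ S', ‖slater v a‖ ^ 2)) := by
    refine Tendsto.const_mul _ (tendsto_finsetSum _ fun a _ => ?_)
    exact ((huv.hasSum_contract_slater a).norm).pow 2
  have hbound : (d + 1) * ∑ a ∈ S', ‖slater v a‖ ^ 2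
      ≤ (d + 1).factorial * (slaterMeasure v').real 𝒜 := by
    refine le_of_tendsto hlim ?_
    filter_upwards [eventually_ge_atTop (S'.biUnion fun a => Finset.univ.image a)] with F hF
    have hu : ∑ x : F, ‖u x‖ ^ 2 ≤ 1 := by
      rw [Finset.sum_coe_sort F fun x => ‖u x‖ ^ 2]
      exact sum_le_hasSum F (fun _ _ => by positivity) (huv.hasSum_norm_sq 0)
    have hanti' : ∀ i j, i ≠ j → ∀ b : Fin (d + 1) → F,
        (fun b : Fin (d + 1) → F => g fun i => b i) (b ∘ Equiv.swap i j)
          = -(fun b : Fin (d + 1) → F => g fun i => b i) b :=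
      fun i j hij b => hanti i j hij fun i => b i
    have h2 := sum_norm_contract_sq_le (u := fun x : F => u x)
      (g := fun b : Fin (d + 1) → F => g fun i => b i) hu hanti'
    have h3 : ∑ b : Fin (d + 1) → F, ‖g fun i => b i‖ ^ 2
        ≤ (d + 1).factorial * (slaterMeasure v').real 𝒜 := by
      rw [← sum_piFinset_const_eq F fun b => ‖g b‖ ^ 2]
      exact sum_le_hasSum _ (fun _ _ => by positivity) hg'
    refine le_trans (mul_le_mul_of_nonneg_left ?_ (by positivity)) (h2.trans h3)
    have h4 : ∀ a : Fin d → F,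
        ‖∑ x : F, star (u x) * g fun i => ((Fin.cons x a : Fin (d + 1) → F) i : E)‖ ^ 2
        = (fun a : Fin d → E => ‖∑ x ∈ F, star (u x) * g (Fin.cons x a)‖ ^ 2) fun i => a i := by
      intro a
      simp only
      rw [← Finset.sum_coe_sort F]
      congr 2
      refine Finset.sum_congr rfl fun x _ => ?_
      congr 2
      ext i
      refine Fin.cases ?_ (fun i => ?_) i <;> simp
    simp only [h4]
    rw [← sum_piFinset_const_eq F
      fun a : Fin d → E => ‖∑ x ∈ F, star (u x) * g (Fin.cons x a)‖ ^ 2]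
    have hsub : S' ⊆ Fintype.piFinset (fun _ : Fin d => F) := by
      intro a ha
      refine Fintype.mem_piFinset.2 fun i => hF ?_
      exact Finset.mem_biUnion.2 ⟨a, ha, Finset.mem_image_of_mem _ (Finset.mem_univ i)⟩
    refine le_trans (le_of_eq ?_)
      (Finset.sum_le_sum_of_subset_of_nonneg hsub fun _ _ _ => by positivity)
    refine Finset.sum_congr rfl fun a ha => ?_
    congr 2
    refine Finset.sum_congr rfl fun x _ => ?_
    -- The only use of the upper set property: on `S'` the cutoff does not affect the contraction.
    have : Set.range (Fin.cons x a : Fin (d + 1) → E) ∈ 𝒜 := by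
      refine hup ?_ (Finset.mem_filter.1 ha).2
      rw [Fin.range_cons]
      exact Set.subset_insert _ _
    simp only [hg, this, if_true]
  rw [Nat.factorial_succ] at hbound
  push_cast at hbound
  rw [div_le_iff₀ hd]
  have hd1 : (0 : ℝ) < d + 1 := by positivity
  refine le_of_mul_le_mul_left ?_ hd1
  linarith

end Domination

/-! ### Strassen's theorem on finite posets -/

section Strassen

open Filter Topology

/-- Layer-cake formula: superlevel sets of a monotone function are upper sets. -/
theorem lintegral_ofReal_le_of_upperSet_le {X : Type*} [Preorder X] [MeasurableSpace X]
    {P Q : Measure X}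
    (h : ∀ U : Set X, IsUpperSet U → MeasurableSet U → P U ≤ Q U) {m : X → ℝ} (hm : Monotone m)
    (hmeas : Measurable m) (h0 : ∀ x, 0 ≤ m x) :
    ∫⁻ x, ENNReal.ofReal (m x) ∂P ≤ ∫⁻ x, ENNReal.ofReal (m x) ∂Q := by
  rw [lintegral_eq_lintegral_meas_lt P (ae_of_all _ h0) hmeas.aemeasurable,
    lintegral_eq_lintegral_meas_lt Q (ae_of_all _ h0) hmeas.aemeasurable]
  refine lintegral_mono fun t => h _ (fun x y hxy hx => lt_of_lt_of_le hx (hm hxy)) ?_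
  exact measurableSet_lt measurable_const hmeas

theorem integral_le_of_upperSet_le {X : Type*} [Finite X] [Preorder X] [MeasurableSpace X]
    [MeasurableSingletonClass X] {P Q : Measure X} [IsProbabilityMeasure P] [IsProbabilityMeasure Q]
    (h : ∀ U : Set X, IsUpperSet U → P U ≤ Q U) {m : X → ℝ} (hm : Monotone m) :
    ∫ x, m x ∂P ≤ ∫ x, m x ∂Q := by
  obtain ⟨c, hc⟩ := (Set.finite_range m).bddBelow
  have h0 : ∀ x, 0 ≤ m x - c := fun x => sub_nonneg.2 (hc ⟨x, rfl⟩)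
  have hmeas : Measurable fun x => m x - c := measurable_of_countable _
  have hle := lintegral_ofReal_le_of_upperSet_le (fun U hU _ => h U hU)
    (fun x y hxy => sub_le_sub_right (hm hxy) c) hmeas h0
  have hP : Integrable (fun x => m x - c) P := .of_finite
  have hQ : Integrable (fun x => m x - c) Q := .of_finite
  rw [← ofReal_integral_eq_lintegral_ofReal hP (ae_of_all _ h0),
    ← ofReal_integral_eq_lintegral_ofReal hQ (ae_of_all _ h0),
    ENNReal.ofReal_le_ofReal_iff (integral_nonneg h0), integral_sub .of_finite .of_finite,
    integral_sub .of_finite .of_finite] at hle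
  simpa using hle

/-- Strassen's theorem on a finite partially ordered set. -/
theorem exists_monotone_coupling_of_finite {X : Type*} [Fintype X] [PartialOrder X]
    [MeasurableSpace X] [MeasurableSingletonClass X] {P Q : Measure X} [IsProbabilityMeasure P]
    [IsProbabilityMeasure Q] (h : ∀ U : Set X, IsUpperSet U → P U ≤ Q U) :
    ∃ μ : Measure (X × X), μ.map Prod.fst = P ∧ μ.map Prod.snd = Q ∧ ∀ᵐ p ∂μ, p.1 ≤ p.2 := by
  classical
  let R := {p : X × X // p.1 ≤ p.2}
  let L : (R → ℝ) →ₗ[ℝ] (X → ℝ) × (X → ℝ) :=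
    ∑ r : R, (LinearMap.proj r).smulRight (Pi.single r.1.1 1, Pi.single r.1.2 1)
  have hL : ∀ w, L w = ∑ r : R, w r •
      ((Pi.single r.1.1 1, Pi.single r.1.2 1) : (X → ℝ) × (X → ℝ)) := fun w => by simp [L]
  have hmem : ((fun x => P.real {x}, fun x => Q.real {x}) : (X → ℝ) × (X → ℝ))
      ∈ L '' stdSimplex ℝ R := by
    -- Duality: a separating functional is a pair of potentials with `α x + β y < c` for `x ≤ y`,
    -- whose total integral against `(P, Q)` exceeds `c`.
    by_contra hnot
    have hcomp : IsCompact (L '' stdSimplex ℝ R) :=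
      (isCompact_stdSimplex ℝ R).image L.continuous_of_finiteDimensional
    obtain ⟨f, c, hf, hc⟩ := geometric_hahn_banach_closed_point
      ((convex_stdSimplex ℝ R).linear_image L) hcomp.isClosed hnot
    let α : X → ℝ := fun x => f (Pi.single x 1, 0)
    let β : X → ℝ := fun x => f (0, Pi.single x 1)
    have hαβ : ∀ x y, x ≤ y → α x + β y < c := by
      intro x y hxy
      have := hf _ ⟨Pi.single (⟨(x, y), hxy⟩ : R) 1, single_mem_stdSimplex ℝ _, rfl⟩
      rw [hL, Finset.sum_eq_single (⟨(x, y), hxy⟩ : R) (by intro r _ hr; simp [hr]) (by simp)] at this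
      simpa [α, β, ← map_add] using this
    have hval : ∀ a b : X → ℝ, f (a, b) = ∑ x, α x * a x + ∑ x, β x * b x := by
      intro a b
      have ha : a = ∑ x, a x • Pi.single x (1 : ℝ) := pi_eq_sum_univ' a |>.trans (by
        refine Finset.sum_congr rfl fun x _ => ?_
        congr 1)
      have hb : b = ∑ x, b x • Pi.single x (1 : ℝ) := pi_eq_sum_univ' b |>.trans (by
        refine Finset.sum_congr rfl fun x _ => ?_
        congr 1)
      have e1 : f (a, 0) = ∑ x, α x * a x := by
        have : ((a, 0) : (X → ℝ) × (X → ℝ)) = ∑ x, a x • (Pi.single x (1 : ℝ), (0 : X → ℝ)) := by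
          refine Prod.ext ?_ ?_
          · rw [Prod.fst_sum]; exact ha
          · rw [Prod.snd_sum]; simp
        rw [this, map_sum]
        exact Finset.sum_congr rfl fun x _ => by rw [map_smul, smul_eq_mul, mul_comm]
      have e2 : f (0, b) = ∑ x, β x * b x := by
        have : ((0, b) : (X → ℝ) × (X → ℝ)) = ∑ x, b x • ((0 : X → ℝ), Pi.single x (1 : ℝ)) := by
          refine Prod.ext ?_ ?_
          · rw [Prod.fst_sum]; simp
          · rw [Prod.snd_sum]; exact hb
        rw [this, map_sum]
        exact Finset.sum_congr rfl fun x _ => by rw [map_smul, smul_eq_mul, mul_comm]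
      rw [← e1, ← e2, ← map_add]
      simp
    have hne : ∀ y : X, (Finset.univ.filter (· ≤ y)).Nonempty := fun y => ⟨y, by simp⟩
    -- The least monotone function above `α`. It lies below `c - β`, so `∫ α dP ≤ ∫ m dP ≤ ∫ m dQ ≤
    -- c - ∫ β dQ`, against the separation.
    let m : X → ℝ := fun y => (Finset.univ.filter (· ≤ y)).sup' (hne y) α
    have hmono : Monotone m := by
      intro y z hyz
      refine Finset.sup'_mono α ?_ (hne y)
      intro x hx
      simp only [Finset.mem_filter, Finset.mem_univ, true_and] at hx ⊢
      exact hx.trans hyz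
    have hαm : ∀ x, α x ≤ m x := fun x => Finset.le_sup' α (by simp)
    have hmβ : ∀ y, m y ≤ c - β y := fun y => by
      refine Finset.sup'_le _ _ fun x hx => ?_
      have := hαβ x y (by simpa using hx)
      linarith
    have hint := integral_le_of_upperSet_le h hmono
    rw [integral_fintype .of_finite, integral_fintype .of_finite] at hint
    simp only [smul_eq_mul] at hint
    rw [hval] at hc
    have hQ1 : ∑ x, Q.real {x} = 1 := by simp
    have s1 : ∑ x, α x * P.real {x} ≤ ∑ x, P.real {x} * m x :=
      Finset.sum_le_sum fun x _ => by
        rw [mul_comm]; exact mul_le_mul_of_nonneg_left (hαm x) measureReal_nonneg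
    have s2 : ∑ x, Q.real {x} * m x ≤ ∑ x, Q.real {x} * (c - β x) :=
      Finset.sum_le_sum fun x _ => mul_le_mul_of_nonneg_left (hmβ x) measureReal_nonneg
    have s3 : ∑ x, Q.real {x} * (c - β x) = c - ∑ x, β x * Q.real {x} := by
      simp only [mul_sub, Finset.sum_sub_distrib, ← Finset.sum_mul, hQ1, one_mul]
      simp only [mul_comm]
    linarith
  obtain ⟨w, hw, hwL⟩ := hmem
  rw [hL] at hwL
  have h1 : ∀ x, P.real {x} = ∑ r : R, w r * if r.1.1 = x then 1 else 0 := by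
    intro x
    have := congrFun (congrArg Prod.fst hwL) x
    simp only [Prod.fst_sum, Finset.sum_apply] at this
    rw [← this]
    refine Finset.sum_congr rfl fun r _ => ?_
    simp [Pi.single_apply, eq_comm]
  have h2 : ∀ x, Q.real {x} = ∑ r : R, w r * if r.1.2 = x then 1 else 0 := by
    intro x
    have := congrFun (congrArg Prod.snd hwL) x
    simp only [Prod.snd_sum, Finset.sum_apply] at this
    rw [← this]
    refine Finset.sum_congr rfl fun r _ => ?_
    simp [Pi.single_apply, eq_comm]
  have hμ : ∀ g : X × X → X, Measurable g → ∀ x,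
      (∑ r : R, ENNReal.ofReal (w r) • Measure.dirac r.1).map g {x}
        = ENNReal.ofReal (∑ r : R, w r * if g r.1 = x then 1 else 0) := by
    intro g hg x
    rw [Measure.map_apply hg (measurableSet_singleton x), Measure.finsetSum_apply,
      ENNReal.ofReal_sum_of_nonneg]
    · refine Finset.sum_congr rfl fun r _ => ?_
      rw [Measure.smul_apply, Measure.dirac_apply' _ (hg (measurableSet_singleton x)), smul_eq_mul,
        ENNReal.ofReal_mul (hw.1 r)]
      congr 1
      by_cases hx : g r.1 = x <;> simp [hx]
    · intro r _
      refine mul_nonneg (hw.1 r) ?_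
      split_ifs <;> simp
  refine ⟨∑ r : R, ENNReal.ofReal (w r) • Measure.dirac r.1, ?_, ?_, ?_⟩
  · refine Measure.ext_of_singleton fun x => ?_
    rw [hμ _ measurable_fst, ← h1, ofReal_measureReal]
  · refine Measure.ext_of_singleton fun x => ?_
    rw [hμ _ measurable_snd, ← h2, ofReal_measureReal]
  · rw [← Measure.sum_fintype, Measure.ae_sum_iff]
    intro r
    refine Measure.ae_smul_measure ?_ _
    rw [ae_dirac_eq]
    exact r.2

end Strassen

/-! ### Compactness, and Strassen's theorem for countable ground sets -/

section Limits

open Filter Topology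

variable {E : Type*}

/-- The pair of sets with given indicator functions. -/
def boolPairToSets (p : (E → Bool) × (E → Bool)) : Set E × Set E :=
  ({e | p.1 e = true}, {e | p.2 e = true})

open Classical in
/-- The indicator functions of a pair of sets. -/
noncomputable def setsToBoolPair (p : Set E × Set E) : (E → Bool) × (E → Bool) :=
  (fun e => decide (e ∈ p.1), fun e => decide (e ∈ p.2))

theorem boolPairToSets_setsToBoolPair (p : Set E × Set E) :
    boolPairToSets (setsToBoolPair p) = p := by
  simp [boolPairToSets, setsToBoolPair]

theorem measurable_boolPairToSets : Measurable (boolPairToSets (E := E)) := by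
  refine Measurable.prodMk ?_ ?_
  · refine measurable_set_iff.2 fun e => ?_
    have hm : Measurable fun p : (E → Bool) × (E → Bool) => p.1 e :=
      (measurable_pi_apply e).comp measurable_fst
    exact measurableSet_setOfPred.1 (hm (measurableSet_singleton true))
  · refine measurable_set_iff.2 fun e => ?_
    have hm : Measurable fun p : (E → Bool) × (E → Bool) => p.2 e :=
      (measurable_pi_apply e).comp measurable_snd
    exact measurableSet_setOfPred.1 (hm (measurableSet_singleton true))

theorem measurable_setsToBoolPair : Measurable (setsToBoolPair (E := E)) := by
  refine Measurable.prodMk ?_ ?_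
  · refine measurable_pi_lambda _ fun e => measurable_to_bool ?_
    convert measurable_fst (measurableSet_mem_set e) using 1
    ext p
    simp
  · refine measurable_pi_lambda _ fun e => measurable_to_bool ?_
    convert measurable_snd (measurableSet_mem_set e) using 1
    ext p
    simp

/-- An event of pairs of sets that is clopen in the product topology. -/
def IsClopenEvent (C : Set (Set E × Set E)) : Prop :=
  IsClopen (boolPairToSets ⁻¹' C)

theorem isClopenEvent_mem_fst (e : E) : IsClopenEvent {p : Set E × Set E | e ∈ p.1} :=
  (isClopen_discrete {true}).preimage ((continuous_apply e).comp continuous_fst)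

theorem isClopenEvent_mem_snd (e : E) : IsClopenEvent {p : Set E × Set E | e ∈ p.2} :=
  (isClopen_discrete {true}).preimage ((continuous_apply e).comp continuous_snd)

theorem IsClopenEvent.inter {C D : Set (Set E × Set E)} (hC : IsClopenEvent C)
    (hD : IsClopenEvent D) : IsClopenEvent (C ∩ D) :=
  IsClopen.inter hC hD

theorem IsClopenEvent.compl {C : Set (Set E × Set E)} (hC : IsClopenEvent C) :
    IsClopenEvent Cᶜ :=
  IsClopen.compl hC

theorem isClopenEvent_biInter {ι : Type*} (A : Finset ι) {C : ι → Set (Set E × Set E)}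
    (hC : ∀ i ∈ A, IsClopenEvent (C i)) : IsClopenEvent (⋂ i ∈ A, C i) := by
  rw [IsClopenEvent, Set.preimage_iInter₂]
  exact isClopen_biInter_finset hC

theorem isClopenEvent_superset_fst (A : Finset E) :
    IsClopenEvent {p : Set E × Set E | (A : Set E) ⊆ p.1} := by
  have : {p : Set E × Set E | (A : Set E) ⊆ p.1} = ⋂ e ∈ A, {p : Set E × Set E | e ∈ p.1} := by
    ext p; simp [Set.subset_def]
  rw [this]
  exact isClopenEvent_biInter A fun e _ => isClopenEvent_mem_fst e

theorem isClopenEvent_superset_snd (A : Finset E) :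
    IsClopenEvent {p : Set E × Set E | (A : Set E) ⊆ p.2} := by
  have : {p : Set E × Set E | (A : Set E) ⊆ p.2} = ⋂ e ∈ A, {p : Set E × Set E | e ∈ p.2} := by
    ext p; simp [Set.subset_def]
  rw [this]
  exact isClopenEvent_biInter A fun e _ => isClopenEvent_mem_snd e

theorem isClopenEvent_mem_diff (e : E) : IsClopenEvent {p : Set E × Set E | e ∈ p.2 \ p.1} :=
  (isClopenEvent_mem_snd e).inter (isClopenEvent_mem_fst e).compl

theorem isClopenEvent_imp (e : E) : IsClopenEvent {p : Set E × Set E | e ∈ p.1 → e ∈ p.2} := by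
  convert ((isClopenEvent_mem_fst e).inter (isClopenEvent_mem_snd e).compl).compl using 1
  ext p
  simp

variable [Countable E]

theorem IsClopenEvent.measurableSet {C : Set (Set E × Set E)} (hC : IsClopenEvent C) :
    MeasurableSet C := by
  have h : C = setsToBoolPair ⁻¹' (boolPairToSets ⁻¹' C) := by
    ext p
    simp [boolPairToSets_setsToBoolPair]
  rw [h]
  exact measurable_setsToBoolPair (IsClopen.isOpen hC).measurableSet

/-- Probability measures on pairs of sets are compact with respect to convergence on clopen
events. -/
theorem exists_limit_measure {α : Type*} (l : Ultrafilter α) (μ : α → Measure (Set E × Set E))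
    (hμ : ∀ a, IsProbabilityMeasure (μ a)) :
    ∃ ν : Measure (Set E × Set E), IsProbabilityMeasure ν ∧
      ∀ C, IsClopenEvent C → Tendsto (fun a => (μ a).real C) l (𝓝 (ν.real C)) := by
  let ρ : α → ProbabilityMeasure ((E → Bool) × (E → Bool)) := fun a =>
    ⟨(μ a).map setsToBoolPair,
      Measure.isProbabilityMeasure_map measurable_setsToBoolPair.aemeasurable⟩
  -- The limit exists because probability measures on this compact space of indicator pairs form a
  -- compact space.
  set ν := (l.map ρ).lim
  have hν : Tendsto ρ l (𝓝 ν) := (l.map ρ).le_nhds_lim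
  refine ⟨(ν : Measure _).map boolPairToSets,
    Measure.isProbabilityMeasure_map measurable_boolPairToSets.aemeasurable, fun C hC => ?_⟩
  have h := ProbabilityMeasure.tendsto_measure_of_isClopen_of_tendsto hν hC
  have h' := (NNReal.continuous_coe.tendsto _).comp h
  rw [measureReal_def, Measure.map_apply measurable_boolPairToSets hC.measurableSet]
  refine h'.congr fun a => ?_
  have e : setsToBoolPair ⁻¹' (boolPairToSets ⁻¹' C) = C := by
    ext p
    simp [boolPairToSets_setsToBoolPair]
  simp only [Function.comp_apply, ρ]
  rw [measureReal_def]
  conv_rhs => rw [← e]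
  rw [← Measure.map_apply measurable_setsToBoolPair (IsClopen.isOpen hC).measurableSet]
  rfl

/-- Reduces monotonicity to countably many clopen events, a form that passes to limits. -/
theorem ae_subset_iff_forall {μ : Measure (Set E × Set E)} [IsProbabilityMeasure μ] :
    (∀ᵐ p ∂μ, p.1 ⊆ p.2) ↔ ∀ e, μ.real {p : Set E × Set E | e ∈ p.1 → e ∈ p.2} = 1 := by
  simp only [Set.subset_def]
  rw [ae_all_iff]
  refine forall_congr' fun e => ?_
  rw [ae_iff_prob_eq_one (measurableSet_setOfPred.1 (isClopenEvent_imp e).measurableSet)]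
  rw [measureReal_def, ENNReal.toReal_eq_one_iff]

/-- Two probability measures on subsets that agree on the events `A ⊆ B` are equal. -/
theorem measure_eq_of_superset {E : Type*} {P P' : Measure (Set E)} [IsProbabilityMeasure P]
    [IsProbabilityMeasure P']
    (h : ∀ A : Finset E, P.real {B : Set E | (A : Set E) ⊆ B} = P'.real {B | (A : Set E) ⊆ B}) :
    P = P' := by
  classical
  refine ext_of_generate_finite {S | ∃ A : Finset E, S = {B : Set E | (A : Set E) ⊆ B}}
    ?_ ?_ ?_ (by simp)
  · apply le_antisymm
    · refine iSup_le fun e => measurable_iff_comap_le.1 ?_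
      refine @measurable_to_prop (Set E) (MeasurableSpace.generateFrom _) (fun B => e ∈ B) ?_
      refine MeasurableSpace.measurableSet_generateFrom ⟨{e}, ?_⟩
      ext B
      simp
    · refine MeasurableSpace.generateFrom_le ?_
      rintro _ ⟨A, rfl⟩
      exact measurableSet_superset A
  · rintro _ ⟨A, rfl⟩ _ ⟨A', rfl⟩ _
    refine ⟨A ∪ A', ?_⟩
    ext B
    simp
  · rintro _ ⟨A, rfl⟩
    simpa [Measure.real, ENNReal.toReal_eq_toReal_iff'] using h A

/-- Strassen's theorem for random subsets of a countable set. -/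
theorem exists_isMonotoneCoupling {P P' : Measure (Set E)} [IsProbabilityMeasure P]
    [IsProbabilityMeasure P']
    (h : ∀ U : Set (Set E), IsUpperSet U → MeasurableSet U → P.real U ≤ P'.real U) :
    ∃ μ, IsMonotoneCoupling μ P P' := by
  classical
  let r : (F : Finset E) → Set E → Set F := fun F B => Subtype.val ⁻¹' B
  have hr : ∀ F, Measurable (r F) := fun F => measurable_set_iff.2 fun e => measurable_set_mem _
  have hstep : ∀ F : Finset E, ∃ μ : Measure (Set F × Set F), μ.map Prod.fst = P.map (r F) ∧
      μ.map Prod.snd = P'.map (r F) ∧ ∀ᵐ p ∂μ, p.1 ≤ p.2 := by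
    intro F
    have := Measure.isProbabilityMeasure_map (μ := P) (hr F).aemeasurable
    have := Measure.isProbabilityMeasure_map (μ := P') (hr F).aemeasurable
    refine exists_monotone_coupling_of_finite fun U hU => ?_
    have hm : MeasurableSet U := U.toFinite.measurableSet
    rw [Measure.map_apply (hr F) hm, Measure.map_apply (hr F) hm]
    have := h (r F ⁻¹' U) (fun B B' hB hBU => hU (Set.preimage_mono hB) hBU) (hr F hm)
    rwa [measureReal_def, measureReal_def,
      ENNReal.toReal_le_toReal (measure_ne_top _ _) (measure_ne_top _ _)] at this
  choose π hπ1 hπ2 hπ3 using hstep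
  -- A coupling of the traces on `F` is read as a pair of subsets of `E` inside `F`; for `A ⊆ F` the
  -- event `A ⊆ B` keeps its exact probability.
  let s : (F : Finset E) → Set F × Set F → Set E × Set E := fun F =>
    Prod.map (Subtype.val '' ·) (Subtype.val '' ·)
  have hs : ∀ F, Measurable (s F) := fun F => measurable_of_countable _
  have hprob : ∀ F, IsProbabilityMeasure ((π F).map (s F)) := by
    intro F
    have h1 : IsProbabilityMeasure (P.map (r F)) :=
      Measure.isProbabilityMeasure_map (μ := P) (hr F).aemeasurable
    rw [← hπ1 F] at h1
    have := Measure.isProbabilityMeasure_of_map (μ := π F) Prod.fst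
    exact Measure.isProbabilityMeasure_map (hs F).aemeasurable
  let l : Ultrafilter (Finset E) := Ultrafilter.of atTop
  obtain ⟨ν, hν, hlim⟩ := exists_limit_measure l (fun F => (π F).map (s F)) hprob
  have hsub : ∀ F A : Finset E, A ⊆ F → ∀ B : Set E,
      (A : Set E) ⊆ Subtype.val '' (r F B) ↔ (A : Set E) ⊆ B := by
    intro F A hAF B
    refine ⟨fun hB e he => ?_, fun hB e he => ⟨⟨e, hAF he⟩, hB he, rfl⟩⟩
    obtain ⟨x, hx, rfl⟩ := hB he
    exact hx
  refine ⟨ν, hν, ?_, ?_, ?_⟩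
  · have := Measure.isProbabilityMeasure_map (μ := ν) measurable_fst.aemeasurable
    refine measure_eq_of_superset fun A => ?_
    rw [map_measureReal_apply measurable_fst (measurableSet_superset A)]
    refine tendsto_nhds_unique (hlim _ (isClopenEvent_superset_fst A)) ?_
    refine tendsto_const_nhds.congr' ?_
    have hA : ∀ᶠ F in (l : Filter (Finset E)), A ⊆ F :=
      Ultrafilter.of_le atTop (eventually_ge_atTop A)
    filter_upwards [hA] with F hAF
    change _ = ((π F).map (s F)).real {p | (A : Set E) ⊆ p.1}
    rw [map_measureReal_apply (hs F) (isClopenEvent_superset_fst A).measurableSet]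
    have e1 : s F ⁻¹' {p : Set E × Set E | (A : Set E) ⊆ p.1}
        = Prod.fst ⁻¹' {B : Set F | (A : Set E) ⊆ Subtype.val '' B} := rfl
    rw [e1, ← map_measureReal_apply measurable_fst (Set.toFinite _).measurableSet, hπ1,
      map_measureReal_apply (hr F) (Set.toFinite _).measurableSet]
    congr 1
    ext B
    exact (hsub F A hAF B).symm
  · have := Measure.isProbabilityMeasure_map (μ := ν) measurable_snd.aemeasurable
    refine measure_eq_of_superset fun A => ?_
    rw [map_measureReal_apply measurable_snd (measurableSet_superset A)]
    refine tendsto_nhds_unique (hlim _ (isClopenEvent_superset_snd A)) ?_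
    refine tendsto_const_nhds.congr' ?_
    have hA : ∀ᶠ F in (l : Filter (Finset E)), A ⊆ F :=
      Ultrafilter.of_le atTop (eventually_ge_atTop A)
    filter_upwards [hA] with F hAF
    change _ = ((π F).map (s F)).real {p | (A : Set E) ⊆ p.2}
    rw [map_measureReal_apply (hs F) (isClopenEvent_superset_snd A).measurableSet]
    have e1 : s F ⁻¹' {p : Set E × Set E | (A : Set E) ⊆ p.2}
        = Prod.snd ⁻¹' {B : Set F | (A : Set E) ⊆ Subtype.val '' B} := rfl
    rw [e1, ← map_measureReal_apply measurable_snd (Set.toFinite _).measurableSet, hπ2,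
      map_measureReal_apply (hr F) (Set.toFinite _).measurableSet]
    congr 1
    ext B
    exact (hsub F A hAF B).symm
  · rw [ae_subset_iff_forall]
    intro e
    refine tendsto_nhds_unique (hlim _ (isClopenEvent_imp e)) ?_
    refine tendsto_const_nhds.congr fun F => ?_
    have hsubF : ∀ᵐ p ∂(π F).map (s F), p.1 ⊆ p.2 := by
      refine (ae_map_iff (hs F).aemeasurable ?_).2 ?_
      · simp only [Set.subset_def, Set.ofPred_forall]
        exact MeasurableSet.iInter fun e => (isClopenEvent_imp e).measurableSet
      · filter_upwards [hπ3 F] with p hp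
        exact Set.image_mono hp
    exact (ae_subset_iff_forall.1 hsubF e).symm

end Limits

/-! ### The law of the difference in any monotone coupling -/

section SingletonDifference

open Filter Topology

variable {𝕜 : Type*} [RCLike 𝕜] {E : Type*} {d : ℕ}

theorem IsKernelMeasure.unique {M : Matrix E E 𝕜} {P P' : Measure (Set E)}
    (h : IsKernelMeasure M P) (h' : IsKernelMeasure M P') : P = P' := by
  have := h.isProbabilityMeasure
  have := h'.isProbabilityMeasure
  refine measure_eq_of_superset fun A => ?_
  rw [← RCLike.ofReal_inj (K := 𝕜), h.prob_superset, h'.prob_superset]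

theorem IsKernelMeasure.prob_mem {M : Matrix E E 𝕜} {P : Measure (Set E)}
    (h : IsKernelMeasure M P) (e : E) : ((P.real {B : Set E | e ∈ B} : ℝ) : 𝕜) = M e e := by
  have h1 := h.prob_superset {e}
  simp only [Finset.coe_singleton, Set.singleton_subset_iff] at h1
  rw [h1]
  convert! Matrix.det_eq_elem_of_subsingleton
    (M.submatrix (fun f : ({e} : Finset E) => (f : E)) (fun f => (f : E)))
    ⟨e, Finset.mem_singleton_self e⟩

theorem IsMonotoneCoupling.prob_mem_diff {μ : Measure (Set E × Set E)} {P P' : Measure (Set E)}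
    (h : IsMonotoneCoupling μ P P') (e : E) :
    μ.real {p : Set E × Set E | e ∈ p.2 \ p.1}
      = P'.real {B : Set E | e ∈ B} - P.real {B : Set E | e ∈ B} := by
  have := h.isProbabilityMeasure
  have hm1 : MeasurableSet {p : Set E × Set E | e ∈ p.1} :=
    measurable_fst (measurableSet_mem_set e)
  rw [← h.map_fst, ← h.map_snd, map_measureReal_apply measurable_fst (measurableSet_mem_set e),
    map_measureReal_apply measurable_snd (measurableSet_mem_set e)]
  have h1 : {p : Set E × Set E | e ∈ p.2 \ p.1}
      = {p : Set E × Set E | e ∈ p.2} \ {p | e ∈ p.1} := by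
    ext p; simp
  rw [h1, measureReal_sdiff' hm1]
  congr 1
  refine measureReal_congr ?_
  filter_upwards [h.ae_subset] with p hp
  exact propext ⟨fun hu => hu.elim id fun h1 => hp h1, Or.inl⟩

theorem familyKernel_cons (u : E → 𝕜) (v : Fin d → E → 𝕜) (e f : E) :
    familyKernel (Fin.cons u v : Fin (d + 1) → E → 𝕜) e f
      = u e * star (u f) + familyKernel v e f := by
  simp [familyKernel, Fin.sum_univ_succ]

theorem IsMonotoneCoupling.prob_mem_diff_eq {u : E → 𝕜} {v : Fin d → E → 𝕜}
    {P P' : Measure (Set E)} (hP : IsKernelMeasure (familyKernel v) P)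
    (hP' : IsKernelMeasure (familyKernel (Fin.cons u v : Fin (d + 1) → E → 𝕜)) P')
    {μ : Measure (Set E × Set E)} (h : IsMonotoneCoupling μ P P') (e : E) :
    μ.real {p : Set E × Set E | e ∈ p.2 \ p.1} = ‖u e‖ ^ 2 := by
  rw [h.prob_mem_diff, ← RCLike.ofReal_inj (K := 𝕜), RCLike.ofReal_sub, hP.prob_mem, hP'.prob_mem,
    familyKernel_cons, RCLike.star_def, RCLike.mul_conj]
  simp

variable [Countable E]

/-- Uniqueness identifies the marginals with Slater measures, whose sets have exactly `d` and `d +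
1` points. -/
theorem IsMonotoneCoupling.ae_encard_diff_eq_one {u : E → 𝕜} {v : Fin d → E → 𝕜}
    (hv : IsOrthonormalFamily v) (huv : IsOrthonormalFamily (Fin.cons u v : Fin (d + 1) → E → 𝕜))
    {P P' : Measure (Set E)} (hP : IsKernelMeasure (familyKernel v) P)
    (hP' : IsKernelMeasure (familyKernel (Fin.cons u v : Fin (d + 1) → E → 𝕜)) P')
    {μ : Measure (Set E × Set E)} (h : IsMonotoneCoupling μ P P') :
    ∀ᵐ p ∂μ, (p.2 \ p.1).encard = 1 := by
  obtain rfl := hP.unique hv.isKernelMeasure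
  obtain rfl := hP'.unique huv.isKernelMeasure
  have h1 := ae_encard_slaterMeasure v
  have h2 := ae_encard_slaterMeasure (Fin.cons u v : Fin (d + 1) → E → 𝕜)
  rw [← h.map_fst] at h1
  rw [← h.map_snd] at h2
  filter_upwards [h.ae_subset, ae_of_ae_map measurable_fst.aemeasurable h1,
    ae_of_ae_map measurable_snd.aemeasurable h2] with p hp hp1 hp2
  have := Set.encard_sdiff_add_encard_of_subset hp
  rw [hp1, hp2, Nat.cast_add, Nat.cast_one, add_comm (d : ℕ∞)] at this
  exact (ENat.add_left_injective_of_ne_top (ENat.natCast_ne_top d)) this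

theorem measure_diff_mem_eq_unitVecMeasure {u : EllTwo 𝕜 E} {μ : Measure (Set E × Set E)}
    [IsFiniteMeasure μ]
    (h1 : ∀ᵐ p ∂μ, (p.2 \ p.1).encard = 1)
    (h2 : ∀ e, μ.real {p : Set E × Set E | e ∈ p.2 \ p.1} = ‖u e‖ ^ 2) {A : Set (Set E)}
    (hA : MeasurableSet A) : μ {p | p.2 \ p.1 ∈ A} = unitVecMeasure u A := by
  classical
  have hm : ∀ e, MeasurableSet {p : Set E × Set E | e ∈ p.2 \ p.1 ∧ ({e} : Set E) ∈ A} :=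
    fun e => (isClopenEvent_mem_diff e).measurableSet.inter (MeasurableSet.const _)
  have hae : μ {p | p.2 \ p.1 ∈ A}
      = μ (⋃ e, {p : Set E × Set E | e ∈ p.2 \ p.1 ∧ ({e} : Set E) ∈ A}) := by
    refine measure_congr ?_
    filter_upwards [h1] with p hp
    obtain ⟨x, hx⟩ := Set.encard_eq_one.1 hp
    refine propext ?_
    change p.2 \ p.1 ∈ A ↔ p ∈ ⋃ e, {p : Set E × Set E | e ∈ p.2 \ p.1 ∧ ({e} : Set E) ∈ A}
    simp only [Set.mem_iUnion, Set.mem_ofPred_eq, hx, Set.mem_singleton_iff]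
    exact ⟨fun h => ⟨x, rfl, h⟩, fun ⟨y, hy, h⟩ => hy ▸ h⟩
  have hdisj : Pairwise (Function.onFun (AEDisjoint μ)
      fun e => {p : Set E × Set E | e ∈ p.2 \ p.1 ∧ ({e} : Set E) ∈ A}) := by
    intro e f hef
    rw [Function.onFun, AEDisjoint, measure_eq_zero_iff_ae_notMem]
    filter_upwards [h1] with p hp hmem
    obtain ⟨x, hx⟩ := Set.encard_eq_one.1 hp
    have he : e ∈ p.2 \ p.1 := hmem.1.1
    have hf : f ∈ p.2 \ p.1 := hmem.2.1
    rw [hx] at he hf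
    exact hef (he.trans hf.symm)
  rw [hae, measure_iUnion₀ hdisj fun e => (hm e).nullMeasurableSet, unitVecMeasure,
    Measure.sum_apply _ hA]
  refine tsum_congr fun e => ?_
  rw [Measure.smul_apply, Measure.dirac_apply' _ hA, smul_eq_mul, ← h2 e, ofReal_measureReal]
  by_cases he : ({e} : Set E) ∈ A <;> simp [he]

end SingletonDifference

/-! ### Adding one vector to an infinite orthonormal family -/

section KernelLimits

open Filter Topology

variable {𝕜 : Type*} [RCLike 𝕜] {E : Type*} {J : Type*}

/-- `μ` is a monotone coupling of the determinantal measures with kernels `M` and `M'`. -/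
structure IsKernelCoupling (M M' : Matrix E E 𝕜) (μ : Measure (Set E × Set E)) : Prop where
  fst : IsKernelMeasure M (μ.map Prod.fst)
  snd : IsKernelMeasure M' (μ.map Prod.snd)
  ae_subset : ∀ᵐ p ∂μ, p.1 ⊆ p.2

theorem IsKernelCoupling.isProbabilityMeasure {M M' : Matrix E E 𝕜} {μ : Measure (Set E × Set E)}
    (h : IsKernelCoupling M M' μ) : IsProbabilityMeasure μ := by
  have := h.fst.isProbabilityMeasure
  exact Measure.isProbabilityMeasure_of_map Prod.fst

theorem IsKernelCoupling.isMonotoneCoupling {M M' : Matrix E E 𝕜} {μ : Measure (Set E × Set E)}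
    (h : IsKernelCoupling M M' μ) :
    IsMonotoneCoupling μ (μ.map Prod.fst) (μ.map Prod.snd) :=
  ⟨h.isProbabilityMeasure, rfl, rfl, h.ae_subset⟩

/-- The kernel of the projection onto the closed span of the functions `w j` with `j ∈ S`. -/
noncomputable def kernelOn (w : J → E → 𝕜) (S : Set J) : Matrix E E 𝕜 :=
  Matrix.of fun e f => ∑' j, S.indicator (fun j => w j e * star (w j f)) j

/-- The functions `w j` are orthonormal and satisfy Bessel's inequality on coordinates. -/
structure IsBesselFamily [DecidableEq J] (w : J → E → 𝕜) : Prop where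
  orthonormal : IsOrthonormalFamily w
  summable : ∀ e, Summable fun j => ‖w j e‖ ^ 2

theorem IsBesselFamily.summable_norm_mul [DecidableEq J] {w : J → E → 𝕜} (hw : IsBesselFamily w)
    (e f : E) : Summable fun j => ‖w j e * star (w j f)‖ := by
  refine ((hw.summable e).add (hw.summable f)).of_nonneg_of_le (fun _ => norm_nonneg _) fun j => ?_
  rw [norm_mul, norm_star]
  nlinarith [sq_nonneg (‖w j e‖ - ‖w j f‖), sq_nonneg (‖w j e‖), sq_nonneg (‖w j f‖)]

/-- Dominated convergence: Bessel's inequality supplies the summable bound, so pointwise eventual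
membership suffices. -/
theorem IsBesselFamily.tendsto_kernelOn [DecidableEq J] {w : J → E → 𝕜} (hw : IsBesselFamily w)
    {α : Type*} {l : Filter α} {T : α → Set J} {S : Set J}
    (h : ∀ j, ∀ᶠ a in l, (j ∈ T a ↔ j ∈ S)) (e f : E) :
    Tendsto (fun a => kernelOn w (T a) e f) l (𝓝 (kernelOn w S e f)) := by
  classical
  refine tendsto_tsum_of_dominated_convergence (hw.summable_norm_mul e f) (fun j => ?_)
    (Eventually.of_forall fun a j => norm_indicator_le_norm_self _ _)
  refine tendsto_const_nhds.congr' ?_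
  filter_upwards [h j] with a ha
  by_cases hj : j ∈ S
  · rw [Set.indicator_of_mem hj, Set.indicator_of_mem (ha.2 hj)]
  · rw [Set.indicator_of_notMem hj, Set.indicator_of_notMem fun h => hj (ha.1 h)]

theorem isKernelMeasure_of_tendsto {α : Type*} {l : Filter α} [l.NeBot] {M : α → Matrix E E 𝕜}
    {M' : Matrix E E 𝕜} {P : α → Measure (Set E)} {P' : Measure (Set E)}
    [hP' : IsProbabilityMeasure P']
    (hP : ∀ a, IsKernelMeasure (M a) (P a))
    (hM : ∀ e f, Tendsto (fun a => M a e f) l (𝓝 (M' e f)))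
    (hlim : ∀ A : Finset E, Tendsto (fun a => (P a).real {B | (A : Set E) ⊆ B}) l
      (𝓝 (P'.real {B | (A : Set E) ⊆ B}))) : IsKernelMeasure M' P' := by
  classical
  refine ⟨hP', fun A => ?_⟩
  refine tendsto_nhds_unique ((RCLike.continuous_ofReal.tendsto _).comp (hlim A)) ?_
  simp only [Function.comp_def, fun a => (hP a).prob_superset A]
  refine ((Continuous.matrix_det continuous_id).tendsto _).comp ?_
  exact tendsto_pi_nhds.2 fun e => tendsto_pi_nhds.2 fun f => hM e f

theorem exists_limit_isKernelCoupling [Countable E] {α : Type*} (l : Ultrafilter α)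
    {M₁ M₂ : α → Matrix E E 𝕜} {N₁ N₂ : Matrix E E 𝕜} {μ : α → Measure (Set E × Set E)}
    (hμ : ∀ a, IsKernelCoupling (M₁ a) (M₂ a) (μ a))
    (h₁ : ∀ e f, Tendsto (fun a => M₁ a e f) l (𝓝 (N₁ e f)))
    (h₂ : ∀ e f, Tendsto (fun a => M₂ a e f) l (𝓝 (N₂ e f))) :
    ∃ ν, IsKernelCoupling N₁ N₂ ν ∧
      ∀ C, IsClopenEvent C → Tendsto (fun a => (μ a).real C) l (𝓝 (ν.real C)) := by
  have hprob := fun a => (hμ a).isProbabilityMeasure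
  obtain ⟨ν, hν, hlim⟩ := exists_limit_measure l μ hprob
  refine ⟨ν, ⟨?_, ?_, ?_⟩, hlim⟩
  · have := Measure.isProbabilityMeasure_map (μ := ν) measurable_fst.aemeasurable
    refine isKernelMeasure_of_tendsto (fun a => (hμ a).fst) h₁ fun A => ?_
    simp only [map_measureReal_apply measurable_fst (measurableSet_superset A)]
    exact hlim _ (isClopenEvent_superset_fst A)
  · have := Measure.isProbabilityMeasure_map (μ := ν) measurable_snd.aemeasurable
    refine isKernelMeasure_of_tendsto (fun a => (hμ a).snd) h₂ fun A => ?_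
    simp only [map_measureReal_apply measurable_snd (measurableSet_superset A)]
    exact hlim _ (isClopenEvent_superset_snd A)
  · rw [ae_subset_iff_forall]
    intro e
    refine tendsto_nhds_unique (hlim _ (isClopenEvent_imp e)) ?_
    refine tendsto_const_nhds.congr fun a => ?_
    exact (ae_subset_iff_forall.1 (hμ a).ae_subset e).symm

theorem kernelOn_finset_eq_familyKernel (w : J → E → 𝕜) (T : Finset J) :
    kernelOn w (T : Set J) = familyKernel fun i : Fin T.card => w (T.equivFin.symm i) := by
  ext e f
  simp only [kernelOn, familyKernel, Matrix.of_apply]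
  rw [Equiv.sum_comp T.equivFin.symm (fun j : T => w j e * star (w j f)),
    Finset.sum_coe_sort T fun j => w j e * star (w j f), tsum_eq_sum (s := T)]
  · exact Finset.sum_congr rfl fun j hj => Set.indicator_of_mem (Finset.mem_coe.2 hj) _
  · intro j hj
    exact Set.indicator_of_notMem (fun h => hj (Finset.mem_coe.1 h)) _

theorem IsBesselFamily.kernelOn_union [DecidableEq J] {w : J → E → 𝕜} (hw : IsBesselFamily w)
    {S R : Set J} (h : Disjoint S R) : kernelOn w (S ∪ R) = kernelOn w S + kernelOn w R := by
  ext e f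
  have hs := (hw.summable_norm_mul e f).of_norm
  simp only [kernelOn, Matrix.of_apply, Matrix.add_apply]
  rw [← (hs.indicator S).tsum_add (hs.indicator R), Set.indicator_union_of_disjoint h]

theorem kernelOn_singleton (w : J → E → 𝕜) (j : J) (e f : E) :
    kernelOn w {j} e f = w j e * star (w j f) := by
  classical
  simp only [kernelOn, Matrix.of_apply]
  rw [tsum_eq_single j fun i hi => Set.indicator_of_notMem (by simpa using hi) _]
  simp

theorem IsOrthonormalFamily.comp [DecidableEq J] {w : J → E → 𝕜} (hw : IsOrthonormalFamily w)
    {J' : Type*} [DecidableEq J'] {g : J' → J} (hg : Function.Injective g) :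
    IsOrthonormalFamily fun i => w (g i) := by
  intro i j
  simpa [hg.eq_iff] using hw (g i) (g j)

theorem kernelOn_finset_isKernelMeasure [DecidableEq J] {w : J → E → 𝕜}
    (hw : IsOrthonormalFamily w) (T : Finset J) :
    ∃ P, IsKernelMeasure (kernelOn w (T : Set J)) P := by
  rw [kernelOn_finset_eq_familyKernel]
  exact ⟨_, (hw.comp (Subtype.val_injective.comp T.equivFin.symm.injective)).isKernelMeasure⟩

/-- The difference of the sets in the pair has at most one point, which is `e` with probability
`‖u e‖ ^ 2`. -/
structure HasSingletonDifference (μ : Measure (Set E × Set E)) (q : E → ℝ) : Prop where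
  prob_mem : ∀ e, μ.real {p : Set E × Set E | e ∈ p.2 \ p.1} = q e
  prob_pair : ∀ e f, e ≠ f →
    μ.real ({p : Set E × Set E | e ∈ p.2 \ p.1} ∩ {p | f ∈ p.2 \ p.1}) = 0

theorem exists_coupling_finset_insert [Countable E] [DecidableEq J] {w : J → E → 𝕜}
    (hw : IsBesselFamily w) (T : Finset J) {j : J} (hj : j ∉ T) :
    ∃ μ, IsKernelCoupling (kernelOn w (T : Set J)) (kernelOn w ((T : Set J) ∪ {j})) μ ∧
      HasSingletonDifference μ fun e => ‖w j e‖ ^ 2 := by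
  set v : Fin T.card → E → 𝕜 := fun i => w (T.equivFin.symm i) with hv_def
  set g : Fin (T.card + 1) → J := Fin.cons j fun i => (T.equivFin.symm i : J) with hg_def
  have hgv : (fun i => w (g i)) = (Fin.cons (w j) v : Fin (T.card + 1) → E → 𝕜) := by
    ext i e
    refine Fin.cases ?_ (fun i => ?_) i <;> simp [g, v]
  have hg : Function.Injective g := by
    rw [hg_def, Fin.cons_injective_iff]
    refine ⟨?_, Subtype.val_injective.comp T.equivFin.symm.injective⟩
    rintro ⟨i, rfl⟩
    exact hj (T.equivFin.symm i).2
  have hv : IsOrthonormalFamily v :=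
    hw.orthonormal.comp (Subtype.val_injective.comp T.equivFin.symm.injective)
  have huv : IsOrthonormalFamily (Fin.cons (w j) v : Fin (T.card + 1) → E → 𝕜) :=
    hgv ▸ hw.orthonormal.comp hg
  have hK : kernelOn w (T : Set J) = familyKernel v := kernelOn_finset_eq_familyKernel w T
  have hK' : kernelOn w ((T : Set J) ∪ {j})
      = familyKernel (Fin.cons (w j) v : Fin (T.card + 1) → E → 𝕜) := by
    rw [hw.kernelOn_union (by simpa using hj), hK]
    ext e f
    rw [Matrix.add_apply, kernelOn_singleton, familyKernel_cons, add_comm]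
  rw [hK, hK']
  have hP := hv.isKernelMeasure
  have hP' := huv.isKernelMeasure
  have := hP.isProbabilityMeasure
  have := hP'.isProbabilityMeasure
  obtain ⟨μ, hμ⟩ := exists_isMonotoneCoupling (P := slaterMeasure v)
    (P' := slaterMeasure (Fin.cons (w j) v : Fin (T.card + 1) → E → 𝕜))
    fun U hU hm => hv.slaterMeasure_le huv hU hm
  refine ⟨μ, ⟨hμ.map_fst ▸ hP, hμ.map_snd ▸ hP', hμ.ae_subset⟩,
    fun e => hμ.prob_mem_diff_eq hP hP' e, fun e f hef => ?_⟩
  rw [measureReal_def, ENNReal.toReal_eq_zero_iff]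
  left
  rw [measure_eq_zero_iff_ae_notMem]
  filter_upwards [hμ.ae_encard_diff_eq_one hv huv hP hP'] with p hp hmem
  obtain ⟨x, hx⟩ := Set.encard_eq_one.1 hp
  have he : e ∈ p.2 \ p.1 := hmem.1
  have hf : f ∈ p.2 \ p.1 := hmem.2
  rw [hx] at he hf
  exact hef (he.trans hf.symm)

/-- The diagonal coupling, for stages at which no vector is added. -/
theorem exists_coupling_self [Countable E] {M : Matrix E E 𝕜} {P : Measure (Set E)}
    (hP : IsKernelMeasure M P) :
    ∃ μ, IsKernelCoupling M M μ ∧ HasSingletonDifference μ fun _ => 0 := by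
  have hm : Measurable fun B : Set E => (B, B) := measurable_id.prodMk measurable_id
  refine ⟨P.map fun B => (B, B), ⟨?_, ?_, ?_⟩, ?_, ?_⟩
  · rw [Measure.map_map measurable_fst hm]
    simpa [Function.comp_def] using hP
  · rw [Measure.map_map measurable_snd hm]
    simpa [Function.comp_def] using hP
  · have := hP.isProbabilityMeasure
    have := Measure.isProbabilityMeasure_map (μ := P) hm.aemeasurable
    rw [ae_subset_iff_forall]
    intro e
    rw [map_measureReal_apply hm (isClopenEvent_imp e).measurableSet]
    simp
  · intro e
    rw [map_measureReal_apply hm (isClopenEvent_mem_diff e).measurableSet]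
    simp
  · intro e f _
    rw [map_measureReal_apply hm
      ((isClopenEvent_mem_diff e).inter (isClopenEvent_mem_diff f)).measurableSet]
    simp

theorem exists_coupling_finset_union [Countable E] [DecidableEq J] {w : J → E → 𝕜}
    (hw : IsBesselFamily w) (T : Finset J) {R : Set J} (hR : R.Subsingleton)
    (hTR : Disjoint (T : Set J) R) :
    ∃ μ, IsKernelCoupling (kernelOn w (T : Set J)) (kernelOn w ((T : Set J) ∪ R)) μ ∧
      HasSingletonDifference μ fun e => ∑' j, R.indicator (fun j => ‖w j e‖ ^ 2) j := by
  rcases hR.eq_empty_or_singleton with rfl | ⟨j, rfl⟩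
  · obtain ⟨P, hP⟩ := kernelOn_finset_isKernelMeasure hw.orthonormal T
    simpa using exists_coupling_self hP
  · have hj : j ∉ T := by simpa using hTR
    convert exists_coupling_finset_insert hw T hj using 5 with μ e
    rw [tsum_eq_single j fun i hi => Set.indicator_of_notMem (by simpa using hi) _]
    simp

theorem HasSingletonDifference.ae_encard_le_one [Countable E] {μ : Measure (Set E × Set E)}
    [IsFiniteMeasure μ] {q : E → ℝ} (h : HasSingletonDifference μ q) :
    ∀ᵐ p ∂μ, (p.2 \ p.1).encard ≤ 1 := by
  have : ∀ᵐ p ∂μ, ∀ e f, e ≠ f → ¬(e ∈ p.2 \ p.1 ∧ f ∈ p.2 \ p.1) := by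
    simp only [ae_all_iff]
    intro e f hef
    have := h.prob_pair e f hef
    rw [measureReal_def, ENNReal.toReal_eq_zero_iff] at this
    exact measure_eq_zero_iff_ae_notMem.1 (this.resolve_right (measure_ne_top _ _))
  filter_upwards [this] with p hp
  rw [Set.encard_le_one_iff]
  intro e f he hf
  by_contra hef
  exact hp e f hef ⟨he, hf⟩

theorem HasSingletonDifference.ae_encard_eq_zero [Countable E] {μ : Measure (Set E × Set E)}
    [IsFiniteMeasure μ] (h : HasSingletonDifference μ fun _ => 0) :
    ∀ᵐ p ∂μ, (p.2 \ p.1).encard = 0 := by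
  have : ∀ᵐ p ∂μ, ∀ e, e ∉ p.2 \ p.1 := by
    rw [ae_all_iff]
    intro e
    have := h.prob_mem e
    rw [measureReal_def, ENNReal.toReal_eq_zero_iff] at this
    exact measure_eq_zero_iff_ae_notMem.1 (this.resolve_right (measure_ne_top _ _))
  filter_upwards [this] with p hp
  rw [Set.encard_eq_zero]
  exact Set.eq_empty_of_forall_notMem hp

/-- The events `e ∈ p.2 \ p.1` are almost disjoint with probabilities summing to one, so almost
surely one of them occurs. -/
theorem HasSingletonDifference.ae_encard_eq_one [Countable E] {μ : Measure (Set E × Set E)}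
    [IsProbabilityMeasure μ] {q : E → ℝ} (h : HasSingletonDifference μ q) (hq : HasSum q 1) :
    ∀ᵐ p ∂μ, (p.2 \ p.1).encard = 1 := by
  have hdisj : Pairwise (Function.onFun (AEDisjoint μ)
      fun e => {p : Set E × Set E | e ∈ p.2 \ p.1}) := by
    intro e f hef
    have := h.prob_pair e f hef
    rw [measureReal_def, ENNReal.toReal_eq_zero_iff] at this
    exact this.resolve_right (measure_ne_top _ _)
  have hm : ∀ e, MeasurableSet {p : Set E × Set E | e ∈ p.2 \ p.1} :=
    fun e => (isClopenEvent_mem_diff e).measurableSet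
  have hq0 : ∀ e, 0 ≤ q e := fun e => h.prob_mem e ▸ measureReal_nonneg
  have hun : μ (⋃ e, {p : Set E × Set E | e ∈ p.2 \ p.1}) = 1 := by
    rw [measure_iUnion₀ hdisj fun e => (hm e).nullMeasurableSet]
    rw [tsum_congr fun e => (ofReal_measureReal (μ := μ)
      (s := {p : Set E × Set E | e ∈ p.2 \ p.1})).symm.trans (congrArg _ (h.prob_mem e))]
    rw [← ENNReal.ofReal_tsum_of_nonneg hq0 hq.summable, hq.tsum_eq, ENNReal.ofReal_one]
  have hae : ∀ᵐ p ∂μ, p ∈ ⋃ e, {p : Set E × Set E | e ∈ p.2 \ p.1} :=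
    (mem_ae_iff_prob_eq_one (MeasurableSet.iUnion hm)).2 hun
  filter_upwards [hae, h.ae_encard_le_one] with p hp hp1
  refine le_antisymm hp1 ?_
  obtain ⟨e, he⟩ := Set.mem_iUnion.1 hp
  exact Set.one_le_encard_iff_nonempty.2 ⟨e, he⟩

/-- Exhaust `S` by finite subsets and take an ultrafilter limit. `HasSingletonDifference` speaks of
clopen events only, so it survives the limit; having exactly one point of difference is then
recovered from it. -/
theorem exists_coupling_union_subsingleton [Countable E] [DecidableEq J] {w : J → E → 𝕜}
    (hw : IsBesselFamily w) {S R : Set J} (hR : R.Subsingleton) (hSR : Disjoint S R) :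
    ∃ μ, IsKernelCoupling (kernelOn w S) (kernelOn w (S ∪ R)) μ ∧
      ∀ᵐ p ∂μ, (p.2 \ p.1).encard = R.encard := by
  classical
  let T : Finset J → Finset J := fun a => a.filter (· ∈ S)
  have hTS : ∀ a, (T a : Set J) ⊆ S := fun a j hj => (Finset.mem_filter.1 hj).2
  choose μ hμ hμ' using fun a =>
    exists_coupling_finset_union hw (T a) hR (hSR.mono_left (hTS a))
  let l : Ultrafilter (Finset J) := Ultrafilter.of atTop
  have hev : ∀ j, ∀ᶠ a in (l : Filter (Finset J)), (j ∈ (T a : Set J) ↔ j ∈ S) := by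
    intro j
    have : ∀ᶠ a in (l : Filter (Finset J)), {j} ⊆ a :=
      Ultrafilter.of_le atTop (eventually_ge_atTop _)
    filter_upwards [this] with a ha
    have : j ∈ a := ha (Finset.mem_singleton_self j)
    simp [T, this]
  obtain ⟨ν, hν, hlim⟩ := exists_limit_isKernelCoupling l hμ
    (fun e f => hw.tendsto_kernelOn hev e f)
    (fun e f => hw.tendsto_kernelOn (S := S ∪ R)
      (fun j => (hev j).mono fun a ha => or_congr_left ha) e f)
  have := hν.isProbabilityMeasure
  refine ⟨ν, hν, ?_⟩
  have hsd : HasSingletonDifference ν fun e => ∑' j, R.indicator (fun j => ‖w j e‖ ^ 2) j := by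
    refine ⟨fun e => ?_, fun e f hef => ?_⟩
    · exact tendsto_nhds_unique (hlim _ (isClopenEvent_mem_diff e))
        (tendsto_const_nhds.congr fun a => ((hμ' a).prob_mem e).symm)
    · exact tendsto_nhds_unique
        (hlim _ ((isClopenEvent_mem_diff e).inter (isClopenEvent_mem_diff f)))
        (tendsto_const_nhds.congr fun a => ((hμ' a).prob_pair e f hef).symm)
  rcases hR.eq_empty_or_singleton with rfl | ⟨j, rfl⟩
  · have e1 : (fun e => ∑' j, (∅ : Set J).indicator (fun j => ‖w j e‖ ^ 2) j)
        = fun _ : E => (0 : ℝ) := by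
      ext e
      simp
    rw [e1] at hsd
    simpa only [Set.encard_empty] using hsd.ae_encard_eq_zero
  · rw [Set.encard_singleton]
    refine hsd.ae_encard_eq_one ?_
    have h1 : IsOrthonormalFamily fun _ : Fin 1 => w j :=
      hw.orthonormal.comp (g := fun _ => j) (Function.injective_of_subsingleton _)
    have e1 : (fun e => ∑' i, ({j} : Set J).indicator (fun i => ‖w i e‖ ^ 2) i)
        = fun e => ‖w j e‖ ^ 2 := by
      ext e
      rw [tsum_eq_single j fun i hi => Set.indicator_of_notMem (by simpa using hi) _]
      simp
    rw [e1]
    exact h1.hasSum_norm_sq 0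

end KernelLimits

/-! ### Gluing couplings into a Markov chain -/

section Chains

open Filter Topology ProbabilityTheory

theorem map_compProd_comap {α β γ : Type*} [MeasurableSpace α] [MeasurableSpace β]
    [MeasurableSpace γ] (μ : Measure α) [SFinite μ] (κ : Kernel β γ) [IsSFiniteKernel κ]
    {f : α → β} (hf : Measurable f) :
    (μ.compProd (κ.comap f hf)).map (Prod.map f id) = (μ.map f).compProd κ := by
  ext s hs
  have hm : Measurable (Prod.map f (id : γ → γ)) := hf.prodMap measurable_id
  rw [Measure.map_apply hm hs, Measure.compProd_apply (hm hs), Measure.compProd_apply hs,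
    lintegral_map (Kernel.measurable_kernel_prodMk_left hs) hf]
  rfl

/-- Couplings of consecutive terms of a sequence of measures come from one random sequence. -/
theorem exists_chain {X : Type*} [MeasurableSpace X] [StandardBorelSpace X] [Nonempty X]
    (μ : ℕ → Measure (X × X)) [hμ : ∀ n, IsProbabilityMeasure (μ n)]
    (h : ∀ n, (μ n).map Prod.snd = (μ (n + 1)).map Prod.fst) :
    ∃ ρ : Measure (ℕ → X), IsProbabilityMeasure ρ ∧
      ∀ n, ρ.map (fun x => (x n, x (n + 1))) = μ n := by
  let ev : ∀ n : ℕ, (Finset.Iic n → X) → X := fun n x => x ⟨n, Finset.mem_Iic.2 le_rfl⟩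
  have hev : ∀ n, Measurable (ev n) := fun n => measurable_pi_apply _
  -- Ionescu-Tulcea construction: the next term is drawn from the conditional law under `μ n` given
  -- the last term alone.
  let κ : (n : ℕ) → Kernel (Finset.Iic n → X) X := fun n => (μ n).condKernel.comap (ev n) (hev n)
  have hκ : ∀ n, IsMarkovKernel (κ n) := fun n => inferInstance
  have hfst : IsProbabilityMeasure (μ 0).fst := inferInstance
  let ρ : Measure (ℕ → X) := Kernel.trajMeasure (X := fun _ => X) (μ 0).fst κ
  have hρ : IsProbabilityMeasure ρ :=
    inferInstanceAs (IsProbabilityMeasure (Kernel.trajMeasure (X := fun _ => X) (μ 0).fst κ))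
  have hstep : ∀ n, ρ.map (fun x => x n) = (μ n).fst →
      ρ.map (fun x => (x n, x (n + 1))) = μ n := by
    intro n hn
    have h1 : (ρ.map (Preorder.frestrictLe n)).compProd (κ n)
        = ρ.map fun x => (Preorder.frestrictLe n x, x (n + 1)) :=
      Kernel.map_frestrictLe_trajMeasure_compProd_eq_map_trajMeasure (X := fun _ => X)
    have h2 := congrArg (fun m => m.map (Prod.map (ev n) id)) h1
    rw [map_compProd_comap, Measure.map_map (hev n) (Preorder.measurable_frestrictLe n),
      Measure.map_map ((hev n).prodMap measurable_id) (by fun_prop)] at h2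
    have h3 : ρ.map (ev n ∘ Preorder.frestrictLe n) = (μ n).fst := hn
    rw [h3, Measure.disintegrate] at h2
    exact h2.symm
  have hmarg : ∀ n, ρ.map (fun x => x n) = (μ n).fst := by
    intro n
    induction n with
    | zero =>
      have h1 : ρ.map (Preorder.frestrictLe 0)
          = (μ 0).fst.map (MeasurableEquiv.piUnique fun _ : Finset.Iic 0 => X).symm := by
        simp only [ρ]
        rw [Kernel.trajMeasure, Measure.map_comp _ _ (Preorder.measurable_frestrictLe 0),
          Kernel.traj_map_frestrictLe, Kernel.partialTraj_self, Measure.id_comp]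
      have h2 := congrArg (fun m => m.map (ev 0)) h1
      rw [Measure.map_map (hev 0) (Preorder.measurable_frestrictLe 0),
        Measure.map_map (hev 0) (MeasurableEquiv.measurable _)] at h2
      exact h2.trans Measure.map_id
    | succ n ih =>
      have h1 := congrArg (fun m => m.map Prod.snd) (hstep n ih)
      rw [Measure.map_map measurable_snd (by fun_prop), h n] at h1
      exact h1
  exact ⟨ρ, hρ, fun n => hstep n (hmarg n)⟩

end Chains

/-! ### Increasing chains of random sets and their union -/

section InfiniteChain

open Filter Topology

variable {𝕜 : Type*} [RCLike 𝕜] {E : Type*} {J : Type*}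

theorem encard_iUnion_eq_tsum {α : Type*} {s : ℕ → Set α}
    (h : Pairwise (Function.onFun Disjoint s)) :
    ((⋃ n, s n).encard : ENNReal) = ∑' n, ((s n).encard : ENNReal) := by
  let _ : MeasurableSpace α := ⊤
  simp only [← fun t : Set α => Measure.count_apply (s := t) trivial]
  exact measure_iUnion h fun _ => trivial

theorem encard_iUnion_sdiff_eq_tsum {α : Type*} {B : ℕ → Set α} (hB : ∀ n, B n ⊆ B (n + 1)) :
    (((⋃ n, B n) \ B 0).encard : ENNReal) = ∑' n, ((B (n + 1) \ B n).encard : ENNReal) := by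
  have hmono : Monotone B := monotone_nat_of_le_succ hB
  rw [← encard_iUnion_eq_tsum]
  · congr 2
    ext x
    simp only [Set.mem_sdiff, Set.mem_iUnion]
    constructor
    · rintro ⟨⟨n, hn⟩, h0⟩
      induction n with
      | zero => exact absurd hn h0
      | succ n ih =>
        by_cases h : x ∈ B n
        · exact ih h
        · exact ⟨n, hn, h⟩
    · rintro ⟨n, hn, hn'⟩
      exact ⟨⟨n + 1, hn⟩, fun h0 => hn' (hmono (Nat.zero_le n) h0)⟩
  · refine (pairwise_disjoint_on _).2 fun m n hmn => ?_
    rw [Set.disjoint_left]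
    rintro x ⟨hx, -⟩ ⟨-, hx'⟩
    exact hx' (hmono hmn hx)

theorem standardBorelSpace_set (E : Type*) [Countable E] : StandardBorelSpace (Set E) :=
  inferInstanceAs (StandardBorelSpace (E → Prop))

theorem measurableSet_encard_sdiff_eq [Countable E] (k : ℕ∞) :
    MeasurableSet {p : Set E × Set E | (p.2 \ p.1).encard = k} := by
  have h : Measurable fun p : Set E × Set E => p.2 \ p.1 := measurable_set_iff.2 fun e =>
    measurableSet_setOfPred.1 (isClopenEvent_mem_diff e).measurableSet
  exact (measurable_encard.comp h) (measurableSet_singleton k)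

/-- Vectors outside `S` are added one at a time, and the union of the resulting increasing chain is
taken. The increments are disjoint, so their sizes add up to `Sᶜ.encard`. -/
theorem exists_coupling_univ [Countable E] [Countable J] [DecidableEq J] {w : J → E → 𝕜}
    (hw : IsBesselFamily w) (S : Set J) :
    ∃ μ, IsKernelCoupling (kernelOn w S) (kernelOn w Set.univ) μ ∧
      ∀ᵐ p ∂μ, (p.2 \ p.1).encard = Sᶜ.encard := by
  have := standardBorelSpace_set E
  obtain ⟨c, hc⟩ := Countable.exists_injective_nat J
  -- Stage `n` adds the vector numbered `n`, if it exists and is not in `S`; hence at most one.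
  let R : ℕ → Set J := fun n => {j | j ∉ S ∧ c j = n}
  let T : ℕ → Set J := fun n => S ∪ {j | c j < n}
  have hR : ∀ n, (R n).Subsingleton := fun n i hi j hj => hc (hi.2.trans hj.2.symm)
  have hTR : ∀ n, Disjoint (T n) (R n) := by
    intro n
    rw [Set.disjoint_left]
    rintro j (hj | hj) hj'
    · exact hj'.1 hj
    · exact absurd hj'.2 (ne_of_lt hj)
  have hT : ∀ n, T n ∪ R n = T (n + 1) := by
    intro n
    ext j
    simp only [T, R, Set.mem_union, Set.mem_ofPred_eq, Order.lt_add_one_iff, le_iff_lt_or_eq]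
    tauto
  have hT0 : T 0 = S := by simp [T]
  choose μ hμ hμ' using fun n => exists_coupling_union_subsingleton hw (hR n) (hTR n)
  simp only [hT] at hμ
  have hprob := fun n => (hμ n).isProbabilityMeasure
  obtain ⟨ρ, hρ, hpair⟩ := exists_chain μ fun n => (hμ n).snd.unique (hμ (n + 1)).fst
  have hm : ∀ n, Measurable fun B : ℕ → Set E => (B n, B (n + 1)) := fun n => by fun_prop
  have hfst : ∀ n, IsKernelMeasure (kernelOn w (T n)) (ρ.map fun B => B n) := by
    intro n
    have h1 := (hμ n).fst
    rwa [← hpair n, Measure.map_map measurable_fst (hm n)] at h1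
  have hsub : ∀ᵐ B ∂ρ, ∀ n, B n ⊆ B (n + 1) := by
    rw [ae_all_iff]
    intro n
    have h1 := (hμ n).ae_subset
    rw [← hpair n] at h1
    exact ae_of_ae_map (hm n).aemeasurable h1
  have hcard : ∀ᵐ B ∂ρ, ∀ n, (B (n + 1) \ B n).encard = (R n).encard := by
    rw [ae_all_iff]
    intro n
    have h1 := hμ' n
    rw [← hpair n] at h1
    exact ae_of_ae_map (hm n).aemeasurable h1
  have hmU : Measurable fun B : ℕ → Set E => ⋃ n, B n := by
    refine measurable_set_iff.2 fun e => ?_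
    simp only [Set.mem_iUnion]
    exact Measurable.exists fun n => (measurable_set_mem e).comp (measurable_pi_apply n)
  have hm0 : Measurable fun B : ℕ → Set E => (B 0, ⋃ n, B n) :=
    (measurable_pi_apply 0).prodMk hmU
  have hRU : ⋃ n, R n = Sᶜ := by
    ext j
    simp [R]
  have hRdisj : Pairwise (Function.onFun Disjoint R) := by
    intro m n hmn
    rw [Function.onFun, Set.disjoint_left]
    rintro j hj hj'
    exact hmn (hj.2.symm.trans hj'.2)
  have hunion : ∀ᵐ B ∂ρ, ((⋃ n, B n) \ B 0).encard = Sᶜ.encard := by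
    filter_upwards [hsub, hcard] with B hB hB'
    rw [← ENat.toENNReal_inj, encard_iUnion_sdiff_eq_tsum hB, ← hRU, encard_iUnion_eq_tsum hRdisj]
    simp only [hB']
  refine ⟨ρ.map fun B => (B 0, ⋃ n, B n), ⟨?_, ?_, ?_⟩, ?_⟩
  · rw [Measure.map_map measurable_fst hm0]
    have := hfst 0
    rwa [hT0] at this
  · rw [Measure.map_map measurable_snd hm0]
    have := Measure.isProbabilityMeasure_map (μ := ρ) hmU.aemeasurable
    -- A finite `A` contained in the union is already contained in some `B n`, so these events
    -- converge along the chain.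
    refine isKernelMeasure_of_tendsto (l := atTop) (P' := ρ.map fun B => ⋃ n, B n) hfst
      (fun e f => hw.tendsto_kernelOn (fun j => ?_) e f) fun A => ?_
    · filter_upwards [eventually_gt_atTop (c j)] with n hn
      simp [T, hn]
    · have hAm : ∀ n, MeasurableSet {B : ℕ → Set E | (A : Set E) ⊆ B n} := by
        intro n
        have hn : Measurable fun B : ℕ → Set E => B n := measurable_pi_apply n
        exact hn (measurableSet_superset A)
      rw [map_measureReal_apply hmU (measurableSet_superset A)]
      refine Tendsto.congr (fun n =>
        (map_measureReal_apply (measurable_pi_apply n) (measurableSet_superset A)).symm) ?_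
      refine (ENNReal.tendsto_toReal (measure_ne_top _ _)).comp ?_
      refine tendsto_measure_of_ae_tendsto_indicator_of_isFiniteMeasure atTop
        (hmU (measurableSet_superset A)) hAm ?_
      filter_upwards [hsub] with B hB
      have hmono : Monotone B := monotone_nat_of_le_succ hB
      by_cases hA : (A : Set E) ⊆ ⋃ n, B n
      · have hev : ∀ e ∈ A, ∀ᶠ n in atTop, e ∈ B n := fun e he => by
          obtain ⟨n, hn⟩ := Set.mem_iUnion.1 (hA he)
          exact (eventually_ge_atTop n).mono fun k hk => hmono hk hn
        filter_upwards [(Filter.eventually_all_finset A).2 hev] with n hn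
        exact ⟨fun _ => hA, fun _ => hn⟩
      · exact Eventually.of_forall fun n =>
          ⟨fun h => absurd (h.trans (Set.subset_iUnion B n)) hA, fun h => absurd h hA⟩
  · refine (ae_map_iff hm0.aemeasurable ?_).2 ?_
    · simp only [Set.subset_def, Set.ofPred_forall]
      exact MeasurableSet.iInter fun e => (isClopenEvent_imp e).measurableSet
    · exact Eventually.of_forall fun B => Set.subset_iUnion B 0
  · exact (ae_map_iff hm0.aemeasurable (measurableSet_encard_sdiff_eq _)).2 hunion

end InfiniteChain

/-! ### Closed subspaces, Hilbert bases and codimension -/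

section HilbertSpace

open Filter Topology

variable {𝕜 : Type*} [RCLike 𝕜] {E : Type*} {J : Type*}

theorem isDetMeasure_iff {K : Submodule 𝕜 (EllTwo 𝕜 E)} [K.HasOrthogonalProjection]
    {P : Measure (Set E)} : IsDetMeasure K P ↔ IsKernelMeasure (projMatrix K) P :=
  ⟨fun h => ⟨h.isProbabilityMeasure, h.prob_superset⟩,
    fun h => ⟨h.isProbabilityMeasure, h.prob_superset⟩⟩

theorem isBesselFamily_of_orthonormal [DecidableEq J] {w : J → EllTwo 𝕜 E} (hw : Orthonormal 𝕜 w) :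
    IsBesselFamily fun j => (w j : E → 𝕜) := by
  classical
  refine ⟨fun i j => ?_, fun e => ?_⟩
  · have h := lp.hasSum_inner (𝕜 := 𝕜) (w j) (w i)
    rw [orthonormal_iff_ite.1 hw] at h
    simpa [eq_comm] using h
  · have h := hw.inner_products_summable (lp.single 2 e (1 : 𝕜))
    refine h.congr fun j => ?_
    rw [norm_inner_symm, lp.inner_single_left]
    simp

/-- Each `w j` is nonzero at some `e`, and for fixed `e` Bessel's inequality allows this for
countably many `j` only. -/
theorem countable_of_orthonormal [Countable E] {w : J → EllTwo 𝕜 E} (hw : Orthonormal 𝕜 w) :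
    Countable J := by
  classical
  have h : (Set.univ : Set J) = ⋃ e : E, Function.support fun j => ‖w j e‖ ^ 2 := by
    refine (Set.eq_univ_of_forall fun j => ?_).symm
    by_contra hj
    refine hw.ne_zero j (lp.ext (funext fun e => ?_))
    simpa using fun h => hj (Set.mem_iUnion.2 ⟨e, h⟩)
  rw [← Set.countable_univ_iff, h]
  exact Set.countable_iUnion fun e =>
    ((isBesselFamily_of_orthonormal hw).summable e).countable_support

theorem projMatrix_eq_kernelOn {K : Submodule 𝕜 (EllTwo 𝕜 E)} [CompleteSpace K]
    (b : HilbertBasis J 𝕜 K) :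
    projMatrix K = kernelOn (fun j => ((b j : EllTwo 𝕜 E) : E → 𝕜)) Set.univ := by
  classical
  ext e f
  have h := b.hasSum_orthogonalProjectionOnto (lp.single 2 f (1 : 𝕜))
  let L : K →L[𝕜] 𝕜 := (lp.evalCLM 𝕜 (fun _ : E => 𝕜) 2 e).comp K.subtypeL
  have h1 : HasSum (fun j => L (inner 𝕜 (b j : EllTwo 𝕜 E) (lp.single 2 f (1 : 𝕜)) • b j))
      (projMatrix K e f) := L.hasSum h
  rw [kernelOn, Matrix.of_apply, ← h1.tsum_eq]
  refine tsum_congr fun j => ?_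
  rw [map_smul, ← inner_conj_symm, lp.inner_single_left, Set.indicator_univ]
  simp [L, lp.evalCLM, mul_comm]

theorem kernelOn_range {J' : Type*} (w : J → E → 𝕜) {g : J' → J} (hg : Function.Injective g) :
    kernelOn w (Set.range g) = kernelOn (fun i => w (g i)) Set.univ := by
  ext e f
  simp only [kernelOn, Matrix.of_apply, Set.indicator_univ]
  rw [← hg.tsum_eq Set.support_indicator_subset]
  simp

theorem projMatrix_eq_add {K U V : Submodule 𝕜 (EllTwo 𝕜 E)} [K.HasOrthogonalProjection]
    [U.HasOrthogonalProjection] [V.HasOrthogonalProjection] (hK : U ⊔ V = K) (hUV : V ≤ Uᗮ) :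
    projMatrix K = projMatrix U + projMatrix V := by
  have h : ∀ x, K.starProjection x = U.starProjection x + V.starProjection x := by
    intro x
    have hVU : U ≤ Vᗮ := (Submodule.isOrtho_iff_le.2 hUV).symm.le
    refine Submodule.eq_starProjection_of_mem_orthogonal ?_ ?_
    · rw [← hK]
      exact Submodule.add_mem_sup (U.starProjection_apply_mem x) (V.starProjection_apply_mem x)
    · rw [← hK, ← Submodule.inf_orthogonal]
      refine ⟨?_, ?_⟩
      · rw [← sub_sub]
        exact sub_mem (U.sub_starProjection_mem_orthogonal x) (hUV (V.starProjection_apply_mem x))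
      · rw [add_comm, ← sub_sub]
        exact sub_mem (V.sub_starProjection_mem_orthogonal x) (hVU (U.starProjection_apply_mem x))
  ext e f
  simp [projMatrix, h]

theorem projMatrix_span_singleton {u : EllTwo 𝕜 E} (hu : ‖u‖ = 1) (e f : E) :
    projMatrix (Submodule.span 𝕜 {u}) e f = u e * star (u f) := by
  classical
  simp only [projMatrix, Matrix.of_apply]
  rw [Submodule.starProjection_unit_singleton 𝕜 hu, ← inner_conj_symm, lp.inner_single_left]
  simp [mul_comm]

/-- A finite Hilbert basis is an algebraic basis. An infinite one is linearly independent, so both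
sides are `⊤`, whatever the exact algebraic dimension. -/
theorem toENat_rank_eq_card {V : Type*} [NormedAddCommGroup V] [InnerProductSpace 𝕜 V]
    (b : HilbertBasis J 𝕜 V) : Cardinal.toENat (Module.rank 𝕜 V) = ENat.card J := by
  rcases finite_or_infinite J with hJ | hJ
  · have := Fintype.ofFinite J
    have hb := b.toOrthonormalBasis.toBasis
    rw [rank_eq_card_basis hb]
    simp
  · rw [ENat.card_eq_top_of_infinite]
    simpa using b.orthonormal.linearIndependent.aleph0_le_rank

theorem codimIn_eq_card {H K : Submodule 𝕜 (EllTwo 𝕜 E)} [H.HasOrthogonalProjection] (h : H ≤ K)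
    (b : HilbertBasis J 𝕜 ↥(Hᗮ ⊓ K)) : codimIn H K = ENat.card J := by
  have hc : IsCompl (H.submoduleOf K) ((Hᗮ ⊓ K).submoduleOf K) := by
    constructor
    · rw [Submodule.disjoint_def]
      intro x hx hx'
      have : (x : EllTwo 𝕜 E) ∈ H ⊓ Hᗮ := ⟨hx, hx'.1⟩
      rw [H.inf_orthogonal_eq_bot] at this
      exact Subtype.ext (by simpa using this)
    · rw [codisjoint_iff, eq_top_iff]
      rintro ⟨x, hx⟩ -
      have h1 : H.starProjection x ∈ H := H.starProjection_apply_mem x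
      have h2 : x - H.starProjection x ∈ Hᗮ := H.sub_starProjection_mem_orthogonal x
      refine Submodule.mem_sup.2 ⟨⟨_, h h1⟩, h1, ⟨_, sub_mem hx (h h1)⟩, ⟨h2, sub_mem hx (h h1)⟩, ?_⟩
      ext1
      simp
  let e := (Submodule.quotientEquivOfIsCompl _ _ hc).trans
    (Submodule.submoduleOfEquivOfLe (inf_le_right : Hᗮ ⊓ K ≤ K))
  rw [codimIn, e.rank_eq, toENat_rank_eq_card b]

/-- Hilbert bases of `H` and of `Hᗮ ⊓ K` together form an orthonormal family giving the kernel of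
`K`; the second one counts the codimension. -/
theorem exists_coupling_of_le [Countable E] {H K : Submodule 𝕜 (EllTwo 𝕜 E)} [CompleteSpace H]
    [CompleteSpace K] (h : H ≤ K) :
    ∃ μ, IsKernelCoupling (projMatrix H) (projMatrix K) μ ∧
      ∀ᵐ p ∂μ, (p.2 \ p.1).encard = codimIn H K := by
  classical
  have hKc : IsClosed (K : Set (EllTwo 𝕜 E)) := (completeSpace_coe_iff_isComplete.1 ‹_›).isClosed
  have hWc : CompleteSpace ↥(Hᗮ ⊓ K) :=
    (H.isClosed_orthogonal.inter hKc).completeSpace_coe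
  obtain ⟨s, b, hb⟩ := exists_hilbertBasis 𝕜 H
  obtain ⟨s', b', hb'⟩ := exists_hilbertBasis 𝕜 ↥(Hᗮ ⊓ K)
  let w : s ⊕ s' → EllTwo 𝕜 E := Sum.elim (fun i => (b i : EllTwo 𝕜 E)) fun i => b' i
  have h1 : Orthonormal 𝕜 fun i => (b i : EllTwo 𝕜 E) :=
    b.orthonormal.comp_linearIsometry H.subtypeₗᵢ
  have h2 : Orthonormal 𝕜 fun i => (b' i : EllTwo 𝕜 E) :=
    b'.orthonormal.comp_linearIsometry (Hᗮ ⊓ K).subtypeₗᵢ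
  have hw : Orthonormal 𝕜 w := by
    refine ⟨?_, ?_⟩
    · rintro (i | i)
      exacts [h1.1 i, h2.1 i]
    · rintro (i | i) (j | j) hij
      · exact h1.2 fun h => hij (congrArg _ h)
      · exact (b' j).2.1 _ (b i).2
      · exact inner_eq_zero_symm.1 ((b' i).2.1 _ (b j).2)
      · exact h2.2 fun h => hij (congrArg _ h)
  have := countable_of_orthonormal hw
  have hB := isBesselFamily_of_orthonormal hw
  have e1 : projMatrix H = kernelOn (fun j => (w j : E → 𝕜)) (Set.range Sum.inl) := by
    rw [kernelOn_range _ Sum.inl_injective, projMatrix_eq_kernelOn b]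
    rfl
  have e2 : projMatrix (Hᗮ ⊓ K) = kernelOn (fun j => (w j : E → 𝕜)) (Set.range Sum.inr) := by
    rw [kernelOn_range _ Sum.inr_injective, projMatrix_eq_kernelOn b']
    rfl
  have e3 : projMatrix K = kernelOn (fun j => (w j : E → 𝕜)) Set.univ := by
    rw [projMatrix_eq_add (Submodule.sup_orthogonal_inf_of_hasOrthogonalProjection h) inf_le_left,
      e1, e2, ← hB.kernelOn_union Set.isCompl_range_inl_range_inr.disjoint,
      Set.range_inl_union_range_inr]
  obtain ⟨μ, hμ, hμ'⟩ := exists_coupling_univ hB (Set.range Sum.inl)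
  rw [← e1, ← e3] at hμ
  refine ⟨μ, hμ, ?_⟩
  rw [codimIn_eq_card h b', ← Set.encard_univ, ← Sum.inr_injective.encard_image (β := s ⊕ s'),
    Set.image_univ, ← Set.compl_range_inl]
  exact hμ'

theorem measure_diff_mem_of_isMonotoneCoupling [Countable E] {H : Submodule 𝕜 (EllTwo 𝕜 E)}
    [FiniteDimensional 𝕜 H] {u : EllTwo 𝕜 E} (hu : ‖u‖ = 1) (huH : u ∈ Hᗮ)
    {P P' : Measure (Set E)} (hP : IsDetMeasure H P)
    (hP' : IsDetMeasure (H ⊔ Submodule.span 𝕜 {u}) P') {μ : Measure (Set E × Set E)}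
    (hμ : IsMonotoneCoupling μ P P') {A : Set (Set E)} (hA : MeasurableSet A) :
    μ {p | p.2 \ p.1 ∈ A} = unitVecMeasure u A := by
  classical
  let b := stdOrthonormalBasis 𝕜 H
  let v : Fin (Module.finrank 𝕜 H) → EllTwo 𝕜 E := fun i => b i
  have hv : Orthonormal 𝕜 v := b.orthonormal.comp_linearIsometry H.subtypeₗᵢ
  have huv : Orthonormal 𝕜 (Fin.cons u v : Fin (Module.finrank 𝕜 H + 1) → EllTwo 𝕜 E) := by
    refine ⟨fun i => ?_, fun i j => ?_⟩
    · refine Fin.cases hu (fun i => hv.1 i) i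
    · refine Fin.cases (Fin.cases ?_ fun j _ => ?_) (fun i => Fin.cases (fun _ => ?_) ?_) i j
      · exact fun h => absurd rfl h
      · exact inner_eq_zero_symm.1 (huH _ (b j).2)
      · exact huH _ (b i).2
      · exact fun j hij => hv.2 fun h => hij (congrArg Fin.succ h)
  let v' : Fin (Module.finrank 𝕜 H) → E → 𝕜 := fun i => v i
  have hvO : IsOrthonormalFamily v' := by
    convert (isBesselFamily_of_orthonormal hv).orthonormal
  have huvO : IsOrthonormalFamily
      (Fin.cons u v' : Fin (Module.finrank 𝕜 H + 1) → E → 𝕜) := by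
    convert (isBesselFamily_of_orthonormal huv).orthonormal with i
    refine Fin.cases ?_ (fun i => ?_) i <;> rfl
  have e1 : projMatrix H = familyKernel v' := by
    rw [projMatrix_eq_kernelOn b.toHilbertBasis]
    ext e f
    simp [kernelOn, familyKernel, v', v]
  have e2 : projMatrix (H ⊔ Submodule.span 𝕜 {u})
      = familyKernel (Fin.cons u v' : Fin (Module.finrank 𝕜 H + 1) → E → 𝕜) := by
    rw [projMatrix_eq_add rfl ((Submodule.span_singleton_le_iff_mem _ _).2 huH), e1]
    ext e f
    rw [Matrix.add_apply, projMatrix_span_singleton hu, familyKernel_cons, add_comm]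
  rw [isDetMeasure_iff, e1] at hP
  rw [isDetMeasure_iff, e2] at hP'
  have := hμ.isProbabilityMeasure
  exact measure_diff_mem_eq_unitVecMeasure (hμ.ae_encard_diff_eq_one hvO huvO hP hP')
    (hμ.prob_mem_diff_eq hP hP') hA

end HilbertSpace

theorem mainTheorem12 {𝕜 : Type*} [RCLike 𝕜] {E : Type*} [Countable E] :
    (∀ H H' : ClosedSubmodule 𝕜 (EllTwo 𝕜 E), H ≤ H' →
      ∃ P P' : Measure (Set E),
        IsDetMeasure H.toSubmodule P ∧ IsDetMeasure H'.toSubmodule P' ∧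
        ∃ μ : Measure (Set E × Set E),
          IsMonotoneCoupling μ P P' ∧
          ∀ᵐ p ∂μ, (p.2 \ p.1).encard = codimIn H.toSubmodule H'.toSubmodule) ∧
    (∀ (H : Submodule 𝕜 (EllTwo 𝕜 E)) [FiniteDimensional 𝕜 H] (u : EllTwo 𝕜 E),
      ‖u‖ = 1 → u ∈ Hᗮ →
      ∀ P P' : Measure (Set E),
        IsDetMeasure H P → IsDetMeasure (H ⊔ Submodule.span 𝕜 {u}) P' →
        ∀ μ : Measure (Set E × Set E), IsMonotoneCoupling μ P P' →
          ∀ A : Set (Set E), MeasurableSet A →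
            μ {p | p.2 \ p.1 ∈ A} = unitVecMeasure u A) := by
  refine ⟨fun H H' h => ?_, fun H _ u hu huH P P' hP hP' μ hμ A hA =>
    measure_diff_mem_of_isMonotoneCoupling hu huH hP hP' hμ hA⟩
  have : CompleteSpace H.toSubmodule := H.isClosed.completeSpace_coe
  have : CompleteSpace H'.toSubmodule := H'.isClosed.completeSpace_coe
  obtain ⟨μ, hμ, hcard⟩ := exists_coupling_of_le (H := H.toSubmodule) (K := H'.toSubmodule) h
  exact ⟨_, _, isDetMeasure_iff.2 hμ.fst, isDetMeasure_iff.2 hμ.snd, μ, hμ.isMonotoneCoupling,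
    hcard⟩
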